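/- Consider a primary link of length $r_{\mathrm p}>0$ whose receiver is at the origin of $\mathbb{R}^2$ and whose transmitter lies on the positive $x$-axis. Let $\Phi_{\mathrm s}=\{\mathbf X_i\}$ be a homogeneous Poisson point process in $\mathbb{R}^2$ of density $\lambda_{\mathrm s}>0$ (the secondary transmitters), let $x_i=\|\mathbf X_i\|$, and let $\theta_i$ be the polar angle of $\mathbf X_i$. The $i$-th secondary transmitter has beam direction $\omega_i$, uniform on $[0,2\pi)$; its fading coefficient to the primary receiver is $G_i\sim\mathrm{Exp}(1)$, and the fading coefficient of the primary link is $H_{\mathrm p}\sim\mathrm{Exp}(1)$ (Rayleigh fading); all of these are independent of each other and of $\Phi_{\mathrm s}$. Let $g_{\mathrm{pr}},g_{\mathrm{pt}},g_{\mathrm{st}}\ge 0$ be measurable $2\pi$-periodic beam patterns (of the primary receiver, the primary transmitter and the secondary transmitters) with $g_{\mathrm{pr}}(0),g_{\mathrm{pt}}(0)>0$. Let $\alpha>2$ be the path-loss exponent, $p_{\mathrm p},p_{\mathrm s}>0$ the transmit powers, $\sigma^2\ge 0$ the noise power, $\rho>0$ the transmit-restriction threshold and $\tau>0$ the SINR threshold.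 Put $$\chi_i=p_{\mathrm s}\,g_{\mathrm{pr}}(\theta_i)\,g_{\mathrm{st}}(\theta_i-\pi-\omega_i)\,x_i^{-\alpha},\qquad U_i=\mathbf 1(\chi_iG_i<\rho),\qquad \mathsf{SINR}_{\mathrm p}=\frac{H_{\mathrm p}\,p_{\mathrm p}\,g_{\mathrm{pt}}(0)g_{\mathrm{pr}}(0)\,r_{\mathrm p}^{-\alpha}}{\sigma^2+\sum_i U_i\chi_iG_i},$$ so that a secondary transmitter is active only if the power received from it at the primary receiver is below $\rho$. Let $$\mathsf n_3=\mathbb E_{\omega}\Big[\int_0^{2\pi}\big[g_{\mathrm{pr}}(\theta)\,g_{\mathrm{st}}(\theta-\pi-\omega)\big]^{2/\alpha}\,\mathrm d\theta\Big]$$ be the average secondary directivity ($\omega$ uniform on $[0,2\pi)$), assumed finite, and $$\kappa_{\mathrm p}=\frac{\rho\, r_{\mathrm p}^{\alpha}}{p_{\mathrm p}\,g_{\mathrm{pt}}(0)g_{\mathrm{pr}}(0)},\qquad \mathsf n_1(\alpha)=\pi\csc(2\pi/\alpha),\qquad \mathsf n_2(\alpha,\nu)=\int_\nu^\infty\frac{e^{-u}}{u\,(u-\nu)^{-2/\alpha}}\,\mathrm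 du .$$ Then the coverage probability $p_{\mathrm{cp}}(\tau,\rho)=\mathbb P[\mathsf{SINR}_{\mathrm p}>\tau]$ is $$p_{\mathrm{cp}}(\tau,\rho)=\exp\!\Big(-\frac{\tau\sigma^2r_{\mathrm p}^\alpha}{p_{\mathrm p}g_{\mathrm{pr}}(0)g_{\mathrm{pt}}(0)}\Big)\exp\!\Big(-\lambda_{\mathrm s}\int_0^{2\pi}\!\!\int_0^\infty\big(1-\mathbb E_{\omega}[K(x,\theta,\omega)]\big)\,x\,\mathrm dx\,\mathrm d\theta\Big),$$ where, with $D=g_{\mathrm{pr}}(\theta)g_{\mathrm{st}}(\theta-\omega-\pi)$ and $D_0=g_{\mathrm{pr}}(0)g_{\mathrm{pt}}(0)$, $$K(x,\theta,\omega)=e^{-\frac{\rho x^\alpha}{p_{\mathrm s}D}}+\frac{1-\exp\!\Big(-\frac{\rho r_{\mathrm p}^\alpha}{p_{\mathrm s}D_0}\Big(\tau\frac{p_{\mathrm s}}{p_{\mathrm p}}+\big(\tfrac{x}{r_{\mathrm p}}\big)^{\alpha}\tfrac{D_0}{D}\Big)\Big)}{\tau\frac{p_{\mathrm s}}{p_{\mathrm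 p}}\frac{1}{(x/r_{\mathrm p})^{\alpha}}\frac{D}{D_0}+1}$$ (both exponentials being $0$ where $D=0$). Moreover, it equals $$p_{\mathrm{cp}}(\tau,\rho)=\exp\!\Big(-\frac{\sigma^2\kappa_{\mathrm p}\tau}{\rho}-\frac{\lambda_{\mathrm s}}{\alpha}\frac{p_{\mathrm s}^{2/\alpha}}{\rho^{2/\alpha}}\Big(\kappa_{\mathrm p}^{2/\alpha}\tau^{2/\alpha}\,\mathsf n_1(\alpha)-\Gamma(2/\alpha)+\mathsf n_2(\alpha,\kappa_{\mathrm p}\tau)\Big)\mathsf n_3\Big).$$ All the integrals in these formulas converge. -/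

import Mathlib

open MeasureTheory ProbabilityTheory Set
open scoped ENNReal

noncomputable section

/-- The number of indices `i` for which the point `X i a` lies in `B`. -/
def pointCount {Ω : Type*} (X : ℕ → Ω → ℂ) (B : Set ℂ) (a : Ω) : ℝ≥0∞ :=
  ∑' i, B.indicator (fun _ => (1 : ℝ≥0∞)) (X i a)

/-- The random points `X 0, X 1, …` of the plane (identified with `ℂ`) form a homogeneous Poisson
point process of intensity `lam`: the number of points in a Borel set of finite area is Poisson
distributed with mean `lam` times the area, and the numbers of points in pairwise disjoint such sets
are independent. For `lam > 0` the process almost surely has infinitely many points, so that it can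
be enumerated by `ℕ`. -/
structure IsPoissonPointProcess {Ω : Type*} [MeasurableSpace Ω] (P : Measure Ω)
    (lam : ℝ) (X : ℕ → Ω → ℂ) : Prop where
  measurable : ∀ i, Measurable (X i)
  hasLaw_count : ∀ B : Set ℂ, MeasurableSet B → volume B ≠ ⊤ →
    HasLaw (pointCount X B)
      ((poissonMeasure (lam * (volume B).toReal).toNNReal).map (fun n : ℕ => (n : ℝ≥0∞))) P
  indep_count : ∀ (n : ℕ) (B : Fin n → Set ℂ), (∀ j, MeasurableSet (B j)) →
    (∀ j, volume (B j) ≠ ⊤) → Pairwise (fun j k => Disjoint (B j) (B k)) →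
    iIndepFun (fun j => pointCount X (B j)) P

/-- A beam pattern: the antenna gain as a function of the angle to the beam orientation, extended
`2π`-periodically to all real angles. The gain may vanish in some directions. -/
structure IsBeamPattern (g : ℝ → ℝ) : Prop where
  measurable : Measurable g
  nonneg : ∀ θ, 0 ≤ g θ
  periodic : Function.Periodic g (2 * Real.pi)

/-- The deterministic parameters of the network. -/
structure NetworkParams where
  /-- path-loss exponent -/
  α : ℝ
  /-- density of the secondary transmitters -/
  lam : ℝ
  /-- transmit-restriction threshold -/
  ρ : ℝ
  /-- transmit power of the secondary transmitters -/
  pS : ℝ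
  /-- transmit power of the primary transmitter -/
  pP : ℝ
  /-- length of the primary link -/
  rP : ℝ
  /-- the thermal noise power is `σ ^ 2` -/
  σ : ℝ
  /-- beam pattern of the primary receiver -/
  gPr : ℝ → ℝ
  /-- beam pattern of the primary transmitter -/
  gPt : ℝ → ℝ
  /-- beam pattern of the secondary transmitters -/
  gSt : ℝ → ℝ

/-- The uniform distribution on the angles `[0, 2π)`. -/
def uniformAngle : Measure ℝ := ProbabilityTheory.cond volume (Ico 0 (2 * Real.pi))

/-- `exp (-t)` for `t ∈ [0, ∞]`, with `exp (-∞) = 0`. -/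
def expNeg (t : ℝ≥0∞) : ℝ := if t = ⊤ then 0 else Real.exp (-t.toReal)

namespace NetworkParams

/-- The joint gain towards the primary receiver (which is at the origin, its beam along the positive
`x`-axis) of a secondary transmitter at polar angle `θ` whose own beam has direction `ω`. -/
def gain (N : NetworkParams) (θ ω : ℝ) : ℝ :=
  N.gPr θ * N.gSt (θ - Real.pi - ω)

/-- The gain of the primary link, whose two beams are aligned. -/
def gain₀ (N : NetworkParams) : ℝ := N.gPr 0 * N.gPt 0

/-- The power that the primary receiver would get from a secondary transmitter at `x` with beam
direction `ω` and fading coefficient `h`. -/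
def receivedPower (N : NetworkParams) (x : ℂ) (ω h : ℝ) : ℝ :=
  N.pS * h * N.gPr x.arg * N.gSt (x.arg - Real.pi - ω) * ‖x‖ ^ (-N.α)

open Classical in
/-- The activity indicator: a secondary transmitter transmits iff the power received from it at the
primary receiver is below `ρ`. -/
def activity (N : NetworkParams) (x : ℂ) (ω h : ℝ) : ℝ :=
  if N.receivedPower x ω h < N.ρ then 1 else 0

variable {Ω : Type*}

/-- The total interference at the primary receiver, a sum in `[0, ∞]`. -/
def interference (N : NetworkParams) (X : ℕ → Ω → ℂ) (ω G : ℕ → Ω → ℝ) (a : Ω) : ℝ≥0∞ :=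
  ∑' i, ENNReal.ofReal
    (N.activity (X i a) (ω i a) (G i a) * N.receivedPower (X i a) (ω i a) (G i a))

/-- The signal to interference plus noise ratio of the primary link, in `[0, ∞]`. -/
def sinr (N : NetworkParams) (X : ℕ → Ω → ℂ) (ω G : ℕ → Ω → ℝ) (H : Ω → ℝ) (a : Ω) : ℝ≥0∞ :=
  ENNReal.ofReal (H a * N.pP * N.gPt 0 * N.gPr 0 * N.rP ^ (-N.α)) /
    (ENNReal.ofReal (N.σ ^ 2) + N.interference X ω G a)

/-- The coverage probability of the primary link at threshold `τ`. -/
def coverage [MeasurableSpace Ω] (N : NetworkParams) (P : Measure Ω)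
    (X : ℕ → Ω → ℂ) (ω G : ℕ → Ω → ℝ) (H : Ω → ℝ) (τ : ℝ) : ℝ :=
  P.real {a | ENNReal.ofReal τ < N.sinr X ω G H a}

/-- The function under the expectation over the beam direction `ω` in the exponent of the coverage
probability, at polar coordinates `x, θ`. The two exponents are computed in `[0, ∞]`, where a
division by a vanishing gain gives `∞`. -/
def kernel (N : NetworkParams) (τ x θ ω : ℝ) : ℝ :=
  expNeg (ENNReal.ofReal (N.ρ * x ^ N.α) / ENNReal.ofReal (N.pS * N.gain θ ω)) +
    (1 - expNeg (ENNReal.ofReal (N.ρ * N.rP ^ N.α / (N.pS * N.gain₀)) *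
        (ENNReal.ofReal (τ * (N.pS / N.pP)) +
          ENNReal.ofReal ((x / N.rP) ^ N.α) *
            (ENNReal.ofReal N.gain₀ / ENNReal.ofReal (N.gain θ ω))))) /
      (τ * (N.pS / N.pP) * (1 / (x / N.rP) ^ N.α) * (N.gain θ ω / N.gain₀) + 1)

/-- The noise-to-signal ratio at the primary receiver. -/
def κ (N : NetworkParams) : ℝ := N.ρ * N.rP ^ N.α / (N.pP * N.gPt 0 * N.gPr 0)

/-- The average secondary directivity. -/
def n₃ (N : NetworkParams) : ℝ :=
  ∫ ω, (∫ θ in (0 : ℝ)..(2 * Real.pi), N.gain θ ω ^ (2 / N.α)) ∂uniformAngle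

end NetworkParams

/-- `π csc (2π/α)` -/
def n₁ (α : ℝ) : ℝ := Real.pi * (Real.sin (2 * Real.pi / α))⁻¹

/-- The integrand of `n₂`. -/
def n₂Integrand (α ν u : ℝ) : ℝ := Real.exp (-u) / (u * (u - ν) ^ (-(2 / α)))

/-- `∫_ν^∞ e^{-u} / (u (u - ν)^{-2/α}) du` -/
def n₂ (α ν : ℝ) : ℝ := ∫ u in Ioi ν, n₂Integrand α ν u

/-- The probabilistic assumptions: the secondary transmitters `X i` form a Poisson point process;
given it, the beam directions `ω i` are i.i.d. uniform and the cross-link fading coefficients `G i`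
are i.i.d. exponential with mean one (Rayleigh fading), independent of each other and of the `X i`;
and the fading coefficient `H` of the primary link is exponential with mean one and independent of
everything else. -/
structure IsNetwork {Ω : Type*} [MeasurableSpace Ω] (P : Measure Ω) (lam : ℝ)
    (X : ℕ → Ω → ℂ) (ω G : ℕ → Ω → ℝ) (H : Ω → ℝ) : Prop where
  poisson : IsPoissonPointProcess P lam X
  measurable_ω : ∀ i, Measurable (ω i)
  measurable_G : ∀ i, Measurable (G i)
  measurable_H : Measurable H
  hasLaw_ω : ∀ i, HasLaw (ω i) uniformAngle P
  hasLaw_G : ∀ i, HasLaw (G i) (expMeasure 1) P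
  hasLaw_H : HasLaw H (expMeasure 1) P
  indep_ω_G : ∀ i, IndepFun (ω i) (G i) P
  indep_marks : iIndepFun (fun i a => (ω i a, G i a)) P
  indep_points_marks : IndepFun (fun a i => X i a) (fun a i => (ω i a, G i a)) P
  indep_H : IndepFun H (fun a => ((fun i => X i a), (fun i => (ω i a, G i a)))) P

end

/-! Conditionally on the interference `I`, the exponential law of `H` turns coverage into `exp (-s
(σ² + I))` with `s = κτ/ρ`. Coverage is therefore a noise factor times the Laplace transform of `I`
at `s` (`measureReal_lt_exp_div`, `coverage_eq_expNeg`). Since `I` is a sum over an independently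
marked Poisson process, `integral_expNeg_tsum_marked` gives `exp (-λ ∫ (1 - L(z)) dz)`, where `L(z)`
is the Laplace transform of the contribution of a transmitter at `z`. Working with `expNeg` on `[0,
∞]` avoids proving beforehand that `I` is finite.

Given its beam direction, a transmitter of positive gain `D` contributes an exponential variable of
mean `q = p_s D x^(-α)`, set to zero from `ρ` on. Its transform is `1 - lossKernel ν t` with `ν = sρ
= κτ` and `t = ρ/q` (`integral_expNeg_truncated_exp`), and this is exactly the kernel `K`. Averaging
over `ω` and passing to polar coordinates gives the first formula.

For the closed form, Tonelli lets the radial integral be done first. Substituting `t = c x^α` with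
`c = ρ/(p_s D)` makes it `c^(-2/α)/α` times the Mellin transform of the loss kernel at `2/α`. The
power of `c` carries `D^(2/α)`, which averages to `n₃`; the three summands of the loss kernel give
`n₁`, `Γ(2/α)` and `n₂` (`hasIntegral_lossKernel`). All integrands are nonnegative, so finiteness of
these values also yields convergence. -/

open Filter Topology

/-! ### The exponential `exp (-t)` on `[0, ∞]` -/

lemma expNeg_eq_toReal_exp (t : ℝ≥0∞) : expNeg t = (EReal.exp (-(t : EReal))).toReal := by
  unfold expNeg
  split_ifs with h
  · simp [h]
  · lift t to NNReal using h
    have : ((t : ℝ≥0∞) : EReal) = ((t : ℝ) : EReal) := rfl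
    rw [this, ← EReal.coe_neg, EReal.exp_coe, ENNReal.toReal_ofReal (Real.exp_pos _).le]
    simp

lemma exp_neg_coe_ne_top (t : ℝ≥0∞) : EReal.exp (-(t : EReal)) ≠ ⊤ := by
  simp

lemma continuous_expNeg : Continuous expNeg := by
  have h : expNeg = fun t : ℝ≥0∞ => (EReal.exp (-(t : EReal))).toReal :=
    funext expNeg_eq_toReal_exp
  rw [h]
  refine continuous_iff_continuousAt.2 fun t => ?_
  refine (ENNReal.continuousAt_toReal (exp_neg_coe_ne_top t)).comp (f := fun t : ℝ≥0∞ =>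
    EReal.exp (-(t : EReal))) ?_
  have : Continuous fun t : ℝ≥0∞ => EReal.exp (-(t : EReal)) :=
    EReal.expHomeomorph.continuous.comp (continuous_neg.comp continuous_coe_ennreal_ereal)
  exact this.continuousAt

lemma measurable_expNeg : Measurable expNeg := continuous_expNeg.measurable

@[simp] lemma expNeg_zero : expNeg 0 = 1 := by simp [expNeg]

@[simp] lemma expNeg_top : expNeg ⊤ = 0 := by simp [expNeg]

lemma expNeg_ofReal {t : ℝ} (ht : 0 ≤ t) : expNeg (ENNReal.ofReal t) = Real.exp (-t) := by
  simp [expNeg, ht]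

lemma expNeg_add (s t : ℝ≥0∞) : expNeg (s + t) = expNeg s * expNeg t := by
  by_cases hs : s = ⊤
  · simp [hs]
  by_cases ht : t = ⊤
  · simp [ht]
  simp only [expNeg, ENNReal.add_eq_top, hs, ht, or_self, if_false, ENNReal.toReal_add hs ht,
    neg_add, Real.exp_add]

lemma expNeg_sum {ι : Type*} (s : Finset ι) (f : ι → ℝ≥0∞) :
    expNeg (∑ i ∈ s, f i) = ∏ i ∈ s, expNeg (f i) := by
  classical
  induction s using Finset.induction_on with
  | empty => simp
  | insert i s hi ih => rw [Finset.sum_insert hi, Finset.prod_insert hi, expNeg_add, ih]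

lemma expNeg_mul_natCast (c : ℝ≥0∞) (n : ℕ) : expNeg (c * n) = expNeg c ^ n := by
  have := expNeg_sum (Finset.range n) fun _ => c
  simpa [mul_comm] using this

lemma expNeg_nonneg (t : ℝ≥0∞) : 0 ≤ expNeg t := by
  unfold expNeg; split_ifs <;> positivity

lemma expNeg_antitone : Antitone expNeg := by
  intro s t h
  obtain ⟨u, rfl⟩ := exists_add_of_le h
  rw [expNeg_add]
  refine mul_le_of_le_one_right (expNeg_nonneg _) ?_
  unfold expNeg
  split_ifs
  · simp
  · simp

lemma expNeg_le_one (t : ℝ≥0∞) : expNeg t ≤ 1 := by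
  simpa using expNeg_antitone (zero_le : 0 ≤ t)

lemma norm_expNeg_le_one (t : ℝ≥0∞) : ‖expNeg t‖ ≤ 1 := by
  rw [Real.norm_of_nonneg (expNeg_nonneg t)]; exact expNeg_le_one t

lemma integrable_expNeg_comp {Ω : Type*} [MeasurableSpace Ω] {P : Measure Ω} [IsFiniteMeasure P]
    {f : Ω → ℝ≥0∞} (hf : Measurable f) : Integrable (fun a => expNeg (f a)) P :=
  Integrable.of_bound (measurable_expNeg.comp hf).aestronglyMeasurable 1
    (ae_of_all _ fun _ => norm_expNeg_le_one _)

lemma expNeg_neg_log {x : ℝ} (h0 : 0 < x) (h1 : x ≤ 1) :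
    expNeg (ENNReal.ofReal (-Real.log x)) = x := by
  rw [expNeg_ofReal (neg_nonneg.2 (Real.log_nonpos h0.le h1)), neg_neg, Real.exp_log h0]

/-- Monotone convergence for the counting measure. -/
lemma ENNReal.tendsto_tsum_of_monotone {f : ℕ → ℕ → ℝ≥0∞} {F : ℕ → ℝ≥0∞}
    (hmono : ∀ i, Monotone fun n => f n i) (hlim : ∀ i, Tendsto (fun n => f n i) atTop (𝓝 (F i))) :
    Tendsto (fun n => ∑' i, f n i) atTop (𝓝 (∑' i, F i)) := by
  simp_rw [← lintegral_count]
  exact lintegral_tendsto_of_tendsto_of_monotone (fun n => (measurable_of_countable _).aemeasurable)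
    (ae_of_all _ hmono) (ae_of_all _ hlim)

/-! ### Laplace functional of a Poisson process -/

/-- The Laplace transform of the Poisson distribution. -/
lemma integral_expNeg_mul_poisson (c : ℝ≥0∞) (m : NNReal) :
    ∫ x, expNeg (c * x) ∂((poissonMeasure m).map (fun n : ℕ => (n : ℝ≥0∞))) =
      Real.exp (-(m * (1 - expNeg c))) := by
  have hm : Measurable fun x : ℝ≥0∞ => expNeg (c * x) :=
    measurable_expNeg.comp (measurable_const.mul measurable_id)
  rw [integral_map (measurable_of_countable _).aemeasurable hm.aestronglyMeasurable,
    integral_poissonMeasure]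
  simp_rw [expNeg_mul_natCast, smul_eq_mul]
  have h := (NormedSpace.expSeries_div_hasSum_exp ((m : ℝ) * expNeg c)).mul_left (Real.exp (-m))
  rw [← Real.exp_eq_exp_ℝ, ← Real.exp_add] at h
  rw [show -((m : ℝ) * (1 - expNeg c)) = -m + m * expNeg c by ring, ← h.tsum_eq]
  refine tsum_congr fun n => ?_
  rw [mul_pow]; ring

lemma measurable_pointCount {Ω : Type*} [MeasurableSpace Ω] {X : ℕ → Ω → ℂ}
    (hX : ∀ i, Measurable (X i)) {B : Set ℂ} (hB : MeasurableSet B) :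
    Measurable (pointCount X B) :=
  Measurable.tsum fun i => (measurable_const.indicator hB).comp (hX i)

namespace IsPoissonPointProcess

variable {Ω : Type*} [MeasurableSpace Ω] {P : Measure Ω} {lam : ℝ} {X : ℕ → Ω → ℂ}

lemma integral_expNeg_pointCount (h : IsPoissonPointProcess P lam X) (hlam : 0 ≤ lam)
    (c : ℝ≥0∞) {B : Set ℂ} (hB : MeasurableSet B) (hvol : volume B ≠ ⊤) :
    ∫ a, expNeg (c * pointCount X B a) ∂P =
      expNeg (ENNReal.ofReal lam * (ENNReal.ofReal (1 - expNeg c) * volume B)) := by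
  have h1 := (h.hasLaw_count B hB hvol).integral_comp (f := fun x => expNeg (c * x))
    (measurable_expNeg.comp (measurable_const.mul measurable_id)).aestronglyMeasurable
  have h2 : 0 ≤ 1 - expNeg c := sub_nonneg.2 (expNeg_le_one c)
  simp only [Function.comp_def] at h1
  rw [h1, integral_expNeg_mul_poisson]
  conv_rhs => rw [← ENNReal.ofReal_toReal hvol]
  rw [← ENNReal.ofReal_mul h2, ← ENNReal.ofReal_mul hlam, expNeg_ofReal (by positivity),
    Real.coe_toNNReal _ (by positivity)]
  ring_nf

/-- The level sets of `f` inside `S` are disjoint and of finite area, so the sum over the points is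
a finite combination of independent Poisson counts, and the expectation factorizes. -/
lemma integral_expNeg_tsum_simple (h : IsPoissonPointProcess P lam X) (hlam : 0 ≤ lam)
    (f : SimpleFunc ℂ ℝ≥0∞) {S : Set ℂ} (hS : MeasurableSet S) (hvol : volume S ≠ ⊤) :
    ∫ a, expNeg (∑' i, S.indicator f (X i a)) ∂P =
      expNeg (ENNReal.ofReal lam * ∫⁻ z, ENNReal.ofReal (1 - expNeg (S.indicator f z))) := by
  let e := f.range.equivFin.symm
  let B : Fin f.range.card → Set ℂ := fun j => f ⁻¹' {(e j : ℝ≥0∞)} ∩ S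
  have hB : ∀ j, MeasurableSet (B j) := fun j => (f.measurableSet_fiber _).inter hS
  have hBvol : ∀ j, volume (B j) ≠ ⊤ := fun j =>
    ne_top_of_le_ne_top hvol (measure_mono inter_subset_right)
  have hdisj : Pairwise fun j k => Disjoint (B j) (B k) := by
    intro j k hjk
    refine Set.disjoint_left.2 fun z hz hz' => hjk ?_
    have h1 : f z = e j := hz.1
    have h2 : f z = e k := hz'.1
    exact e.injective (Subtype.ext (h1.symm.trans h2))
  -- Needed twice: with the identity for the sum over the points, and with `1 - expNeg` for the
  -- integral over the plane. The condition `g 0 = 0` handles the points outside `S`.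
  have key : ∀ {M : Type} [AddCommMonoid M] (g : ℝ≥0∞ → M) (_ : g 0 = 0) (z : ℂ),
      g (S.indicator f z) = ∑ j, (B j).indicator (fun _ => g (e j)) z := by
    intro M _ g hg z
    by_cases hz : z ∈ S
    · rw [Set.indicator_of_mem hz]
      have hr : f z ∈ f.range := f.mem_range_self z
      rw [Finset.sum_eq_single (e.symm ⟨f z, hr⟩)]
      · rw [Set.indicator_of_mem]
        · simp
        · exact ⟨by simp, hz⟩
      · intro j _ hj
        refine Set.indicator_of_notMem (fun hz' => hj ?_) _
        rw [Equiv.eq_symm_apply]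
        exact Subtype.ext (Eq.symm hz'.1)
      · simp
    · rw [Set.indicator_of_notMem hz, hg]
      refine (Finset.sum_eq_zero fun j _ => ?_).symm
      exact Set.indicator_of_notMem (fun hz' => hz hz'.2) _
  have hsum : ∀ a, ∑' i, S.indicator f (X i a) = ∑ j, (e j : ℝ≥0∞) * pointCount X (B j) a := by
    intro a
    simp_rw [pointCount, ← ENNReal.tsum_mul_left]
    rw [← Summable.tsum_finsetSum fun _ _ => ENNReal.summable]
    refine tsum_congr fun i => ?_
    rw [key (fun x => x) rfl]
    refine Finset.sum_congr rfl fun j _ => ?_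
    by_cases hz : X i a ∈ B j <;> simp [hz]
  have hint : ∫⁻ z, ENNReal.ofReal (1 - expNeg (S.indicator f z)) =
      ∑ j, ENNReal.ofReal (1 - expNeg (e j)) * volume (B j) := by
    simp_rw [key (fun x => ENNReal.ofReal (1 - expNeg x)) (by simp)]
    rw [lintegral_finsetSum _ fun j _ => measurable_const.indicator (hB j)]
    exact Finset.sum_congr rfl fun j _ => lintegral_indicator_const (hB j) _
  have hmeas : ∀ j : Fin f.range.card, Measurable fun x : ℝ≥0∞ => expNeg ((e j : ℝ≥0∞) * x) :=
    fun j => measurable_expNeg.comp (measurable_const.mul measurable_id)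
  simp_rw [hsum, expNeg_sum]
  have hind := (h.indep_count _ B hB hBvol hdisj).comp
    (fun j x => expNeg ((e j : ℝ≥0∞) * x)) hmeas
  have h3 := hind.integral_fun_prod_eq_prod_integral fun j =>
    ((hmeas j).comp (measurable_pointCount h.measurable (hB j))).aestronglyMeasurable
  simp only [Function.comp_def] at h3
  rw [h3, hint, Finset.mul_sum, expNeg_sum]
  exact Finset.prod_congr rfl fun j _ => h.integral_expNeg_pointCount hlam _ (hB j) (hBvol j)

variable [IsProbabilityMeasure P]

/-- The Laplace functional of a homogeneous Poisson point process. -/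
theorem integral_expNeg_tsum (h : IsPoissonPointProcess P lam X) (hlam : 0 ≤ lam)
    {F : ℂ → ℝ≥0∞} (hF : Measurable F) :
    ∫ a, expNeg (∑' i, F (X i a)) ∂P =
      expNeg (ENNReal.ofReal lam * ∫⁻ z, ENNReal.ofReal (1 - expNeg (F z))) := by
  -- Simple functions cut off to balls increase to `F`; the cut-off supplies the finite area
  -- required for the counts.
  let S : ℕ → Set ℂ := fun n => Metric.closedBall 0 n
  let f : ℕ → ℂ → ℝ≥0∞ := fun n => (S n).indicator (SimpleFunc.eapprox F n)
  have hS : ∀ n, MeasurableSet (S n) := fun n => measurableSet_closedBall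
  have hfm : ∀ n, Measurable (f n) := fun n => (SimpleFunc.measurable _).indicator (hS n)
  have hmono : ∀ z, Monotone fun n => f n z := by
    intro z m n hmn
    refine (Set.indicator_le_indicator (SimpleFunc.monotone_eapprox F hmn z)).trans ?_
    exact Set.indicator_le_indicator_of_subset
      (Metric.closedBall_subset_closedBall (by exact_mod_cast hmn)) (fun _ => zero_le) z
  have hlim : ∀ z, Tendsto (fun n => f n z) atTop (𝓝 (F z)) := by
    intro z
    have h1 : Tendsto (fun n => SimpleFunc.eapprox F n z) atTop (𝓝 (F z)) :=
      SimpleFunc.tendsto_eapprox hF z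
    refine h1.congr' ?_
    obtain ⟨k, hk⟩ := exists_nat_ge ‖z‖
    filter_upwards [eventually_ge_atTop k] with n hn
    refine (Set.indicator_of_mem ?_ _).symm
    simp only [S, mem_closedBall_zero_iff]
    exact hk.trans (by exact_mod_cast hn)
  have h1 : Tendsto (fun n => ∫ a, expNeg (∑' i, f n (X i a)) ∂P) atTop
      (𝓝 (∫ a, expNeg (∑' i, F (X i a)) ∂P)) := by
    refine tendsto_integral_of_dominated_convergence (fun _ => 1) (fun n => ?_)
      (integrable_const _) (fun n => ae_of_all _ fun a => norm_expNeg_le_one _)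
      (ae_of_all _ fun a => ?_)
    · exact (measurable_expNeg.comp (Measurable.tsum fun i =>
        (hfm n).comp (h.measurable i))).aestronglyMeasurable
    · exact (continuous_expNeg.tendsto _).comp
        (ENNReal.tendsto_tsum_of_monotone (fun i => hmono _) fun i => hlim _)
  have h2 : Tendsto (fun n => ∫⁻ z, ENNReal.ofReal (1 - expNeg (f n z))) atTop
      (𝓝 (∫⁻ z, ENNReal.ofReal (1 - expNeg (F z)))) := by
    refine lintegral_tendsto_of_tendsto_of_monotone (fun n => ?_) (ae_of_all _ fun z m n hmn => ?_)
      (ae_of_all _ fun z => ?_)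
    · exact (ENNReal.measurable_ofReal.comp
        (measurable_const.sub (measurable_expNeg.comp (hfm n)))).aemeasurable
    · exact ENNReal.ofReal_le_ofReal (sub_le_sub_left (expNeg_antitone (hmono z hmn)) _)
    · exact (ENNReal.continuous_ofReal.tendsto _).comp
        (tendsto_const_nhds.sub ((continuous_expNeg.tendsto _).comp (hlim z)))
  have h3 := (continuous_expNeg.tendsto _).comp
    (ENNReal.Tendsto.const_mul h2 (Or.inr (ENNReal.ofReal_ne_top (r := lam))))
  refine tendsto_nhds_unique h1 (h3.congr fun n => ?_)
  exact (h.integral_expNeg_tsum_simple hlam _ (hS n)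
    (measure_closedBall_lt_top).ne).symm

end IsPoissonPointProcess

/-! ### Independent marks -/

/-- Independence gives the product formula for finitely many marks, and dominated convergence the
limit. Writing the product as `expNeg` of a sum of `-log` terms, which needs positive factors, puts
it in the form handled by the unmarked Laplace functional. -/
lemma integral_expNeg_tsum_of_iIndepFun {Ω E : Type*} [MeasurableSpace Ω] [MeasurableSpace E]
    {P : Measure Ω} [IsProbabilityMeasure P] {ν : Measure E} [IsProbabilityMeasure ν]
    {M : ℕ → Ω → E} (hM : ∀ i, Measurable (M i)) (hlaw : ∀ i, HasLaw (M i) ν P)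
    (hind : iIndepFun M P) {h : ℕ → E → ℝ≥0∞} (hh : ∀ i, Measurable (h i))
    (hpos : ∀ i, 0 < ∫ m, expNeg (h i m) ∂ν) :
    ∫ a, expNeg (∑' i, h i (M i a)) ∂P =
      expNeg (∑' i, ENNReal.ofReal (-Real.log (∫ m, expNeg (h i m) ∂ν))) := by
  have hle : ∀ i, ∫ m, expNeg (h i m) ∂ν ≤ 1 := fun i => by
    simpa using integral_mono (integrable_expNeg_comp (hh i)) (integrable_const (μ := ν) (1 : ℝ))
      fun m => expNeg_le_one (h i m)
  have hfin : ∀ n, ∫ a, expNeg (∑ i ∈ Finset.range n, h i (M i a)) ∂P =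
      expNeg (∑ i ∈ Finset.range n, ENNReal.ofReal (-Real.log (∫ m, expNeg (h i m) ∂ν))) := by
    intro n
    simp_rw [expNeg_sum, expNeg_neg_log (hpos _) (hle _)]
    have h1 := (hind.precomp (g := fun i : Fin n => (i : ℕ)) Fin.val_injective).comp
      (fun i m => expNeg (h i m)) fun i => measurable_expNeg.comp (hh i)
    have h2 := h1.integral_fun_prod_eq_prod_integral fun i =>
      ((measurable_expNeg.comp (hh i)).comp (hM i)).aestronglyMeasurable
    simp only [Function.comp_def] at h2
    simp_rw [Finset.prod_range]
    rw [h2]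
    exact Finset.prod_congr rfl fun i _ => (hlaw i).integral_comp
      (f := fun m => expNeg (h i m)) (measurable_expNeg.comp (hh i)).aestronglyMeasurable
  have h1 : Tendsto (fun n => ∫ a, expNeg (∑ i ∈ Finset.range n, h i (M i a)) ∂P) atTop
      (𝓝 (∫ a, expNeg (∑' i, h i (M i a)) ∂P)) := by
    refine tendsto_integral_of_dominated_convergence (fun _ => 1) (fun n => ?_)
      (integrable_const _) (fun n => ae_of_all _ fun a => norm_expNeg_le_one _)
      (ae_of_all _ fun a => ?_)
    · exact (measurable_expNeg.comp (Finset.measurable_fun_sum _ fun i _ =>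
        (hh i).comp (hM i))).aestronglyMeasurable
    · exact (continuous_expNeg.tendsto _).comp (ENNReal.tendsto_nat_tsum _)
  refine tendsto_nhds_unique h1 ?_
  simp_rw [hfin]
  exact (continuous_expNeg.tendsto _).comp (ENNReal.tendsto_nat_tsum _)

/-- The Laplace functional of an independently marked homogeneous Poisson point process. -/
theorem IsPoissonPointProcess.integral_expNeg_tsum_marked {Ω E : Type*} [MeasurableSpace Ω]
    [MeasurableSpace E] {P : Measure Ω} [IsProbabilityMeasure P] {ν : Measure E}
    [IsProbabilityMeasure ν] {lam : ℝ} {X : ℕ → Ω → ℂ} (hX : IsPoissonPointProcess P lam X)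
    (hlam : 0 ≤ lam) {M : ℕ → Ω → E} (hM : ∀ i, Measurable (M i))
    (hlaw : ∀ i, HasLaw (M i) ν P) (hind : iIndepFun M P)
    (hXM : IndepFun (fun a i => X i a) (fun a i => M i a) P)
    {h : ℂ × E → ℝ≥0∞} (hh : Measurable h) (hpos : ∀ z, 0 < ∫ m, expNeg (h (z, m)) ∂ν) :
    ∫ a, expNeg (∑' i, h (X i a, M i a)) ∂P =
      expNeg (ENNReal.ofReal lam *
        ∫⁻ z, ENNReal.ofReal (1 - ∫ m, expNeg (h (z, m)) ∂ν)) := by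
  have hXm : Measurable fun a i => X i a := measurable_pi_lambda _ hX.measurable
  have hMm : Measurable fun a i => M i a := measurable_pi_lambda _ hM
  have hle : ∀ z, ∫ m, expNeg (h (z, m)) ∂ν ≤ 1 := fun z => by
    simpa using integral_mono (integrable_expNeg_comp (hh.comp measurable_prodMk_left))
      (integrable_const (μ := ν) (1 : ℝ)) fun m => expNeg_le_one (h (z, m))
  have hΦ : Measurable fun p : (ℕ → ℂ) × (ℕ → E) => ∑' i, h (p.1 i, p.2 i) :=
    Measurable.tsum fun i => hh.comp
      (((measurable_pi_apply i).comp measurable_fst).prodMk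
        ((measurable_pi_apply i).comp measurable_snd))
  have : IsProbabilityMeasure (P.map fun a i => X i a) :=
    Measure.isProbabilityMeasure_map hXm.aemeasurable
  have : IsProbabilityMeasure (P.map fun a i => M i a) :=
    Measure.isProbabilityMeasure_map hMm.aemeasurable
  -- With the points frozen at `x`, only the independent marks are averaged.
  have hinner : ∀ x : ℕ → ℂ, ∫ m, expNeg (∑' i, h (x i, m i)) ∂(P.map fun a i => M i a) =
      expNeg (∑' i, ENNReal.ofReal (-Real.log (∫ m, expNeg (h (x i, m)) ∂ν))) := by
    intro x
    refine (integral_map hMm.aemeasurable (measurable_expNeg.comp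
      (hΦ.comp (measurable_prodMk_left (x := x)))).aestronglyMeasurable).trans ?_
    exact integral_expNeg_tsum_of_iIndepFun hM hlaw hind
      (fun i => hh.comp measurable_prodMk_left) fun i => hpos _
  have hφ : Measurable fun z => ENNReal.ofReal (-Real.log (∫ m, expNeg (h (z, m)) ∂ν)) := by
    have : StronglyMeasurable fun z => ∫ m, expNeg (h (z, m)) ∂ν :=
      (measurable_expNeg.comp hh).stronglyMeasurable.integral_prod_right (f := fun z m =>
        expNeg (h (z, m)))
    exact ENNReal.measurable_ofReal.comp (Real.measurable_log.comp this.measurable).neg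
  calc ∫ a, expNeg (∑' i, h (X i a, M i a)) ∂P
      = ∫ p, expNeg (∑' i, h (p.1 i, p.2 i))
          ∂(P.map fun a => ((fun i => X i a), fun i => M i a)) :=
        (integral_map (hXm.prodMk hMm).aemeasurable
          (measurable_expNeg.comp hΦ).aestronglyMeasurable).symm
    _ = ∫ x, ∫ m, expNeg (∑' i, h (x i, m i)) ∂(P.map fun a i => M i a)
          ∂(P.map fun a i => X i a) := by
        rw [hXM.map_prod_eq_prod_map_map hXm.aemeasurable hMm.aemeasurable, integral_prod]
        exact integrable_expNeg_comp hΦ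
    _ = ∫ a, expNeg (∑' i, ENNReal.ofReal (-Real.log (∫ m, expNeg (h (X i a, m)) ∂ν))) ∂P := by
        simp_rw [hinner]
        exact integral_map hXm.aemeasurable (measurable_expNeg.comp (Measurable.tsum fun i =>
          hφ.comp (measurable_pi_apply i))).aestronglyMeasurable
    _ = _ := by
        -- The unmarked functional is applied to `-log` of the mean over a mark; `expNeg` then
        -- undoes the logarithm.
        rw [hX.integral_expNeg_tsum hlam hφ]
        simp_rw [expNeg_neg_log (hpos _) (hle _)]

/-! ### Averaging over the fading of the primary link -/

lemma expMeasure_real_Ioi {t : ℝ} (ht : 0 ≤ t) : (expMeasure 1).real (Ioi t) = Real.exp (-t) := by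
  have := isProbabilityMeasure_expMeasure one_pos
  have h1 := cdf_expMeasure_eq one_pos t
  rw [cdf_eq_real, if_pos ht] at h1
  rw [← compl_Iic, probReal_compl_eq_one_sub measurableSet_Iic, h1]
  simp

/-- The complementary distribution function of a scaled exponential variable divided by
`t ∈ [0, ∞]`. -/
lemma expMeasure_real_lt_div {τ c : ℝ} (hτ : 0 < τ) (hc : 0 < c) (t : ℝ≥0∞) :
    (expMeasure 1).real {h | ENNReal.ofReal τ < ENNReal.ofReal (h * c) / t} =
      expNeg (ENNReal.ofReal (τ / c) * t) := by
  by_cases ht : t = ⊤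
  · subst ht
    have : ENNReal.ofReal (τ / c) ≠ 0 := by simpa using div_pos hτ hc
    simp [this]
  lift t to NNReal using ht
  have hset : {h | ENNReal.ofReal τ < ENNReal.ofReal (h * c) / (t : ℝ≥0∞)} = Ioi (τ / c * t) := by
    ext h
    simp only [mem_ofPred_eq, mem_Ioi]
    -- For `t = 0` the quotient is `⊤` if `h > 0`, and `0 / 0 = 0` otherwise, so the event is still
    -- `h > 0`.
    rcases eq_or_ne t 0 with rfl | ht
    · by_cases hh : 0 < h
      · have : ENNReal.ofReal (h * c) ≠ 0 := by simpa using mul_pos hh hc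
        simp [ENNReal.div_zero this, hh]
      · have : ENNReal.ofReal (h * c) = 0 := by
          simpa using mul_nonpos_of_nonpos_of_nonneg (not_lt.1 hh) hc.le
        simp [this, hh]
    · have h0 : (0 : ℝ) < t := by positivity
      rw [ENNReal.lt_div_iff_mul_lt (by simp [ht]) (by simp), ← ENNReal.ofReal_coe_nnreal,
        ← ENNReal.ofReal_mul hτ.le, ENNReal.ofReal_lt_ofReal_iff_of_nonneg (by positivity),
        div_mul_eq_mul_div, div_lt_iff₀ hc]
  rw [hset, expMeasure_real_Ioi (by positivity), ← ENNReal.ofReal_coe_nnreal,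
    ← ENNReal.ofReal_mul (by positivity), expNeg_ofReal (by positivity)]

/-- Averaging out an exponential variable that is independent of the denominator. -/
lemma measureReal_lt_exp_div {Ω E : Type*} [MeasurableSpace Ω] [MeasurableSpace E]
    {P : Measure Ω} [IsProbabilityMeasure P] {H : Ω → ℝ} {Y : Ω → E} (hH : Measurable H)
    (hY : Measurable Y) (hlaw : HasLaw H (expMeasure 1) P) (hind : IndepFun H Y P)
    {J : E → ℝ≥0∞} (hJ : Measurable J) {τ c : ℝ} (hτ : 0 < τ) (hc : 0 < c) :
    P.real {a | ENNReal.ofReal τ < ENNReal.ofReal (H a * c) / J (Y a)} =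
      ∫ a, expNeg (ENNReal.ofReal (τ / c) * J (Y a)) ∂P := by
  have := isProbabilityMeasure_expMeasure one_pos
  have : IsProbabilityMeasure (P.map Y) := Measure.isProbabilityMeasure_map hY.aemeasurable
  have hS : MeasurableSet {p : ℝ × E | ENNReal.ofReal τ < ENNReal.ofReal (p.1 * c) / J p.2} :=
    measurableSet_lt measurable_const ((ENNReal.measurable_ofReal.comp
      (measurable_fst.mul_const c)).div (hJ.comp measurable_snd))
  have h1 := map_measureReal_apply (μ := P) (hH.prodMk hY) hS
  rw [hind.map_prod_eq_prod_map_map hH.aemeasurable hY.aemeasurable, hlaw.map_eq] at h1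
  refine (h1.symm.trans ?_)
  rw [measureReal_def, Measure.prod_apply_symm hS, ← integral_toReal
    (measurable_measure_prodMk_right hS).aemeasurable (ae_of_all _ fun _ => measure_lt_top _ _),
    integral_map hY.aemeasurable
      (measurable_measure_prodMk_right hS).ennreal_toReal.aestronglyMeasurable]
  exact integral_congr_ae (ae_of_all _ fun a => expMeasure_real_lt_div hτ hc (J (Y a)))

/-! ### Coverage as a Laplace functional -/

instance isProbabilityMeasure_uniformAngle : IsProbabilityMeasure uniformAngle := by
  refine cond_isProbabilityMeasure_of_finite ?_ ?_
  · simp [Real.pi_pos]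
  · simp [ENNReal.mul_eq_top]

instance isProbabilityMeasure_expMeasure_one : IsProbabilityMeasure (expMeasure 1) :=
  isProbabilityMeasure_expMeasure one_pos

namespace NetworkParams

variable (N : NetworkParams)

lemma measurable_gain (hPr : IsBeamPattern N.gPr) (hSt : IsBeamPattern N.gSt) :
    Measurable fun q : ℝ × ℝ => N.gain q.1 q.2 :=
  (hPr.measurable.comp measurable_fst).mul
    (hSt.measurable.comp ((measurable_fst.sub_const _).sub measurable_snd))

lemma gain_nonneg (hPr : IsBeamPattern N.gPr) (hSt : IsBeamPattern N.gSt) (θ ω : ℝ) :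
    0 ≤ N.gain θ ω := mul_nonneg (hPr.nonneg _) (hSt.nonneg _)

lemma gain_add_two_pi (hPr : IsBeamPattern N.gPr) (hSt : IsBeamPattern N.gSt) (θ ω : ℝ) :
    N.gain (θ + 2 * Real.pi) ω = N.gain θ ω := by
  unfold gain
  rw [hPr.periodic, show θ + 2 * Real.pi - Real.pi - ω = θ - Real.pi - ω + 2 * Real.pi by ring,
    hSt.periodic]

/-- The interference caused by a single secondary transmitter. -/
noncomputable def contribution (x : ℂ) (ω h : ℝ) : ℝ := N.activity x ω h * N.receivedPower x ω h

lemma receivedPower_eq (x : ℂ) (ω h : ℝ) :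
    N.receivedPower x ω h = h * (N.pS * N.gain x.arg ω * ‖x‖ ^ (-N.α)) := by
  unfold receivedPower gain; ring

lemma measurable_receivedPower (hPr : IsBeamPattern N.gPr) (hSt : IsBeamPattern N.gSt) :
    Measurable fun q : ℂ × ℝ × ℝ => N.receivedPower q.1 q.2.1 q.2.2 := by
  simp_rw [receivedPower_eq]
  have h1 : Measurable fun q : ℂ × ℝ × ℝ => N.gain q.1.arg q.2.1 :=
    (N.measurable_gain hPr hSt).comp ((Complex.measurable_arg.comp measurable_fst).prodMk
      (measurable_fst.comp measurable_snd))
  fun_prop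

lemma measurable_contribution (hPr : IsBeamPattern N.gPr) (hSt : IsBeamPattern N.gSt) :
    Measurable fun q : ℂ × ℝ × ℝ => N.contribution q.1 q.2.1 q.2.2 := by
  have h1 := N.measurable_receivedPower hPr hSt
  refine Measurable.mul ?_ h1
  exact Measurable.ite (measurableSet_lt h1 measurable_const) measurable_const measurable_const

lemma contribution_le (hρ : 0 ≤ N.ρ) (x : ℂ) (ω h : ℝ) : N.contribution x ω h ≤ N.ρ := by
  unfold contribution activity
  split_ifs with hlt
  · simpa using hlt.le
  · simpa using hρ

/-- The Laplace transform at `s` of the interference caused by a secondary transmitter at `z`. -/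
noncomputable def contributionLaplace (s : ℝ) (z : ℂ) : ℝ :=
  ∫ m, expNeg (ENNReal.ofReal s * ENNReal.ofReal (N.contribution z m.1 m.2))
    ∂(uniformAngle.prod (expMeasure 1))

lemma measurable_weighted_contribution (hPr : IsBeamPattern N.gPr) (hSt : IsBeamPattern N.gSt)
    (s : ℝ) : Measurable fun q : ℂ × ℝ × ℝ =>
      ENNReal.ofReal s * ENNReal.ofReal (N.contribution q.1 q.2.1 q.2.2) :=
  measurable_const.mul (ENNReal.measurable_ofReal.comp (N.measurable_contribution hPr hSt))

/-- The activity rule bounds each contribution by `ρ`, so the transform is at least `exp (-sρ)`.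
This positivity is what the logarithms in the marked functional require. -/
lemma contributionLaplace_pos (hPr : IsBeamPattern N.gPr) (hSt : IsBeamPattern N.gSt)
    (hρ : 0 ≤ N.ρ) (s : ℝ) (z : ℂ) : 0 < N.contributionLaplace s z := by
  have h1 : expNeg (ENNReal.ofReal s * ENNReal.ofReal N.ρ) ≤ N.contributionLaplace s z := by
    have := integral_mono (μ := uniformAngle.prod (expMeasure 1))
      (integrable_const (expNeg (ENNReal.ofReal s * ENNReal.ofReal N.ρ)))
      (integrable_expNeg_comp
        ((N.measurable_weighted_contribution hPr hSt s).comp (measurable_prodMk_left (x := z))))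
      fun m => expNeg_antitone
        (mul_le_mul_right (ENNReal.ofReal_le_ofReal (N.contribution_le hρ z m.1 m.2)) _)
    simpa [contributionLaplace] using this
  refine lt_of_lt_of_le ?_ h1
  unfold expNeg
  rw [if_neg (ENNReal.mul_ne_top ENNReal.ofReal_ne_top ENNReal.ofReal_ne_top)]
  exact Real.exp_pos _

/-- The coverage probability in terms of the Laplace functional of the marked Poisson process. -/
theorem coverage_eq_expNeg {Ω : Type*} [MeasurableSpace Ω] {P : Measure Ω}
    [IsProbabilityMeasure P] {X : ℕ → Ω → ℂ} {ω G : ℕ → Ω → ℝ} {H : Ω → ℝ} {τ : ℝ}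
    (hlam : 0 < N.lam) (hρ : 0 < N.ρ) (hpP : 0 < N.pP) (hrP : 0 < N.rP) (hτ : 0 < τ)
    (hPr : IsBeamPattern N.gPr) (hSt : IsBeamPattern N.gSt)
    (hPr0 : 0 < N.gPr 0) (hPt0 : 0 < N.gPt 0) (hnet : IsNetwork P N.lam X ω G H) :
    N.coverage P X ω G H τ =
      expNeg (ENNReal.ofReal (N.κ * τ / N.ρ) * ENNReal.ofReal (N.σ ^ 2)) *
        expNeg (ENNReal.ofReal N.lam *
          ∫⁻ z, ENNReal.ofReal (1 - N.contributionLaplace (N.κ * τ / N.ρ) z)) := by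
  set s := N.κ * τ / N.ρ with hs
  set c := N.pP * N.gPt 0 * N.gPr 0 * N.rP ^ (-N.α) with hc
  have hc0 : 0 < c := by positivity
  have hsc : τ / c = s := by
    rw [hs, hc, κ, Real.rpow_neg hrP.le]
    field_simp
  have hX := hnet.poisson.measurable
  let Y : Ω → (ℕ → ℂ) × (ℕ → ℝ × ℝ) := fun a => ((fun i => X i a), (fun i => (ω i a, G i a)))
  have hM : ∀ i, Measurable fun a => (ω i a, G i a) := fun i =>
    (hnet.measurable_ω i).prodMk (hnet.measurable_G i)
  have hY : Measurable Y :=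
    (measurable_pi_lambda _ hX).prodMk (measurable_pi_lambda _ hM)
  let J : (ℕ → ℂ) × (ℕ → ℝ × ℝ) → ℝ≥0∞ := fun p => ENNReal.ofReal (N.σ ^ 2) +
    ∑' i, ENNReal.ofReal (N.contribution (p.1 i) (p.2 i).1 (p.2 i).2)
  have hJ : Measurable J := by
    refine measurable_const.add (Measurable.tsum fun i => ENNReal.measurable_ofReal.comp ?_)
    have h1 : Measurable fun p : (ℕ → ℂ) × (ℕ → ℝ × ℝ) => (p.1 i, p.2 i) := by fun_prop
    exact (N.measurable_contribution hPr hSt).comp h1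
  have h1 : N.coverage P X ω G H τ =
      P.real {a | ENNReal.ofReal τ < ENNReal.ofReal (H a * c) / J (Y a)} := by
    unfold coverage sinr interference
    simp only [hc, J, Y, contribution, mul_assoc]
  rw [h1, measureReal_lt_exp_div hnet.measurable_H hY hnet.hasLaw_H hnet.indep_H hJ hτ hc0, hsc]
  have hlaw : ∀ i, HasLaw (fun a => (ω i a, G i a)) (uniformAngle.prod (expMeasure 1)) P := fun i =>
    (indepFun_iff_hasLaw_prodMk_prod (hnet.hasLaw_ω i) (hnet.hasLaw_G i)).1 (hnet.indep_ω_G i)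
  have h2 := hnet.poisson.integral_expNeg_tsum_marked hlam.le hM hlaw hnet.indep_marks
    hnet.indep_points_marks (N.measurable_weighted_contribution hPr hSt s)
    (N.contributionLaplace_pos hPr hSt hρ.le s)
  unfold contributionLaplace
  rw [← h2, ← integral_const_mul]
  refine integral_congr_ae (ae_of_all _ fun a => ?_)
  simp only [J, Y, mul_add, expNeg_add, ENNReal.tsum_mul_left]

end NetworkParams

/-! ### Laplace transform of a truncated exponential variable -/

lemma integral_expMeasure_one (f : ℝ → ℝ) :
    ∫ g, f g ∂(expMeasure 1) = ∫ g in Ioi 0, Real.exp (-g) * f g := by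
  have h : expMeasure 1 = volume.withDensity (exponentialPDF 1) := rfl
  rw [h, integral_withDensity_eq_integral_toReal_smul
    (show Measurable (exponentialPDF 1) from (measurable_exponentialPDFReal 1).ennreal_ofReal)
    (ae_of_all _ fun _ => ENNReal.ofReal_lt_top),
    ← integral_Ici_eq_integral_Ioi, ← integral_indicator measurableSet_Ici]
  congr 1 with g
  by_cases hg : 0 ≤ g
  · rw [indicator_of_mem (mem_Ici.2 hg), exponentialPDF_of_nonneg hg,
      ENNReal.toReal_ofReal (by positivity)]
    simp
  · rw [indicator_of_notMem (by simpa using hg), exponentialPDF_of_neg (not_le.1 hg)]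
    simp

/-- The complement of the Laplace transform of the interference of one transmitter, in terms of
`ν`, the product of the threshold and the transform variable, and `t`, the quotient of the threshold
and the mean received power. -/
noncomputable def lossKernel (ν t : ℝ) : ℝ :=
  ν / (t + ν) - Real.exp (-t) + t * Real.exp (-(t + ν)) / (t + ν)

lemma integral_exp_neg_mul_Ioo {a t : ℝ} (ha : a ≠ 0) (ht : 0 ≤ t) :
    ∫ g in Ioo 0 t, Real.exp (-(a * g)) = (1 - Real.exp (-(a * t))) / a := by
  rw [← integral_Ioc_eq_integral_Ioo, ← intervalIntegral.integral_of_le ht]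
  have := intervalIntegral.integral_comp_mul_left (a := 0) (b := t) (fun x => Real.exp (-x)) ha
  rw [this, intervalIntegral.integral_comp_neg (fun x => Real.exp x)]
  simp
  ring

/-- The Laplace transform of an exponential variable with mean `q`, set to zero above `ρ`. -/
lemma integral_expNeg_truncated_exp {s ρ q : ℝ} (hs : 0 < s) (hρ : 0 < ρ) (hq : 0 < q) :
    ∫ g, expNeg (ENNReal.ofReal s * ENNReal.ofReal ((if g * q < ρ then 1 else 0) * (g * q)))
      ∂(expMeasure 1) = 1 - lossKernel (s * ρ) (ρ / q) := by
  have ht : 0 < ρ / q := by positivity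
  have hsq : 0 < 1 + s * q := by positivity
  -- The transmitter is active for `g < ρ/q` and silent from there on; the silent range produces the
  -- term `exp (-t)` of the transform.
  have h1 : EqOn (fun g => Real.exp (-g) * expNeg (ENNReal.ofReal s *
      ENNReal.ofReal ((if g * q < ρ then 1 else 0) * (g * q))))
      (fun g => Real.exp (-((1 + s * q) * g))) (Ioo 0 (ρ / q)) := by
    intro g hg
    have h2 : g * q < ρ := (lt_div_iff₀ hq).1 hg.2
    have h3 : 0 < g := hg.1
    simp only [if_pos h2, one_mul]
    rw [← ENNReal.ofReal_mul hs.le, expNeg_ofReal (by positivity), ← Real.exp_add]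
    ring_nf
  have h2 : EqOn (fun g => Real.exp (-g) * expNeg (ENNReal.ofReal s *
      ENNReal.ofReal ((if g * q < ρ then 1 else 0) * (g * q))))
      (fun g => Real.exp (-g)) (Ici (ρ / q)) := by
    intro g hg
    have h2 : ¬ g * q < ρ := not_lt.2 ((div_le_iff₀ hq).1 hg)
    simp [if_neg h2]
  have hi1 : IntegrableOn (fun g => Real.exp (-((1 + s * q) * g))) (Ioo 0 (ρ / q)) :=
    ((Continuous.integrableOn_Icc (by fun_prop)).mono_set Ioo_subset_Icc_self)
  have hi2 : IntegrableOn (fun g => Real.exp (-g)) (Ici (ρ / q)) :=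
    (integrableOn_Ici_iff_integrableOn_Ioi).2 (integrableOn_exp_neg_Ioi _)
  rw [integral_expMeasure_one, ← Ioo_union_Ici_eq_Ioi ht, setIntegral_union
    (show Disjoint (Ioo 0 (ρ / q)) (Ici (ρ / q)) from
      Set.disjoint_left.2 fun x hx hx' => not_le.2 hx.2 hx') measurableSet_Ici
    ((integrableOn_congr_fun h1 measurableSet_Ioo).2 hi1)
    ((integrableOn_congr_fun h2 measurableSet_Ici).2 hi2),
    setIntegral_congr_fun measurableSet_Ioo h1, setIntegral_congr_fun measurableSet_Ici h2,
    integral_exp_neg_mul_Ioo hsq.ne' ht.le, integral_Ici_eq_integral_Ioi, integral_exp_neg_Ioi,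
    lossKernel]
  have e1 : (1 + s * q) * (ρ / q) = ρ / q + s * ρ := by field_simp
  have e2 : ρ / q + s * ρ = (1 + s * q) * ρ / q := by field_simp
  rw [e1]
  generalize Real.exp (-(ρ / q + s * ρ)) = E
  rw [e2]
  field_simp
  ring

/-! ### Mellin transform of the loss kernel -/

section Integrals

variable {δ ν : ℝ}

lemma lintegral_rpow_mul_exp_neg {a r : ℝ} (ha : 0 < a) (hr : 0 < r) :
    ∫⁻ t in Ioi (0 : ℝ), ENNReal.ofReal (t ^ (a - 1) * Real.exp (-(r * t))) =
      ENNReal.ofReal ((1 / r) ^ a * Real.Gamma a) := by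
  have h := Real.integral_rpow_mul_exp_neg_mul_Ioi ha hr
  have hpos : 0 < (1 / r) ^ a * Real.Gamma a :=
    mul_pos (by positivity) (Real.Gamma_pos_of_pos ha)
  rw [← h, ofReal_integral_eq_lintegral_ofReal]
  -- A nonintegrable function has integral `0` by convention, which contradicts the positive value.
  · by_contra hc
    rw [integral_undef hc] at h
    exact hpos.ne h
  · filter_upwards [ae_restrict_mem measurableSet_Ioi] with t ht
    have : (0 : ℝ) < t := ht
    positivity

/-- Write `1/(t + ν)` as the integral of `exp (-(t + ν) y)` over `y > 0` and swap by Tonelli. Two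
Gamma integrals remain, and the reflection formula evaluates `Γ(δ) Γ(1 - δ)`. -/
lemma lintegral_rpow_div_add (h0 : 0 < δ) (h1 : δ < 1) (hν : 0 < ν) :
    ∫⁻ t in Ioi (0 : ℝ), ENNReal.ofReal (t ^ (δ - 1) / (t + ν)) =
      ENNReal.ofReal (ν ^ (δ - 1) * (Real.pi / Real.sin (Real.pi * δ))) := by
  have hinner : ∀ t ∈ Ioi (0 : ℝ), ENNReal.ofReal (t ^ (δ - 1) / (t + ν)) =
      ∫⁻ y in Ioi (0 : ℝ), ENNReal.ofReal (t ^ (δ - 1) * Real.exp (-((t + ν) * y))) := by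
    intro t ht
    have ht' : (0 : ℝ) < t := ht
    have := lintegral_rpow_mul_exp_neg one_pos (add_pos ht' hν)
    simp only [sub_self, Real.rpow_zero, one_mul, Real.rpow_one, Real.Gamma_one, mul_one] at this
    have hp : (0 : ℝ) ≤ t ^ (δ - 1) := by positivity
    simp_rw [ENNReal.ofReal_mul hp]
    rw [lintegral_const_mul _ (by fun_prop), this, ← ENNReal.ofReal_mul hp]
    ring_nf
  have houter : ∀ y ∈ Ioi (0 : ℝ),
      ∫⁻ t in Ioi (0 : ℝ), ENNReal.ofReal (t ^ (δ - 1) * Real.exp (-((t + ν) * y))) =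
        ENNReal.ofReal (Real.Gamma δ) *
          ENNReal.ofReal (y ^ ((1 - δ) - 1) * Real.exp (-(ν * y))) := by
    intro y hy
    have hy' : (0 : ℝ) < y := hy
    have := lintegral_rpow_mul_exp_neg h0 hy'
    have he : ∀ t : ℝ, t ^ (δ - 1) * Real.exp (-((t + ν) * y)) =
        Real.exp (-(ν * y)) * (t ^ (δ - 1) * Real.exp (-(y * t))) := by
      intro t
      rw [mul_left_comm, ← Real.exp_add]
      ring_nf
    simp_rw [he, ENNReal.ofReal_mul (Real.exp_pos (-(ν * y))).le]
    rw [lintegral_const_mul _ (by fun_prop), this, ← ENNReal.ofReal_mul (Real.exp_pos _).le,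
      ← ENNReal.ofReal_mul (Real.Gamma_pos_of_pos h0).le, one_div, Real.inv_rpow hy'.le,
      ← Real.rpow_neg hy'.le]
    ring_nf
  rw [setLIntegral_congr_fun measurableSet_Ioi hinner, lintegral_lintegral_swap,
    setLIntegral_congr_fun measurableSet_Ioi houter, lintegral_const_mul _ (by fun_prop),
    lintegral_rpow_mul_exp_neg (sub_pos.2 h1) hν, ← ENNReal.ofReal_mul
    (Real.Gamma_pos_of_pos h0).le, ← Real.Gamma_mul_Gamma_one_sub, one_div, Real.inv_rpow hν.le,
    ← Real.rpow_neg hν.le]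
  · ring_nf
  · exact Measurable.aemeasurable (by fun_prop)

lemma hasIntegral_rpow_mul_div_add (h0 : 0 < δ) (h1 : δ < 1) (hν : 0 < ν) :
    IntegrableOn (fun t => t ^ (δ - 1) * (ν / (t + ν))) (Ioi 0) ∧
      ∫ t in Ioi 0, t ^ (δ - 1) * (ν / (t + ν)) =
        ν ^ δ * (Real.pi / Real.sin (Real.pi * δ)) := by
  have hs : 0 < Real.sin (Real.pi * δ) :=
    Real.sin_pos_of_pos_of_lt_pi (by positivity) (by nlinarith [Real.pi_pos])
  have hnn : 0 ≤ᵐ[volume.restrict (Ioi 0)] fun t : ℝ => t ^ (δ - 1) / (t + ν) := by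
    filter_upwards [ae_restrict_mem measurableSet_Ioi] with t ht
    have : (0 : ℝ) < t := ht
    show (0 : ℝ) ≤ t ^ (δ - 1) / (t + ν)
    positivity
  have hm : AEStronglyMeasurable (fun t : ℝ => t ^ (δ - 1) / (t + ν))
      (volume.restrict (Ioi 0)) := Measurable.aestronglyMeasurable (by fun_prop)
  have hl := lintegral_rpow_div_add h0 h1 hν
  have hi : IntegrableOn (fun t : ℝ => t ^ (δ - 1) / (t + ν)) (Ioi 0) :=
    (lintegral_ofReal_ne_top_iff_integrable hm hnn).1 (by rw [hl]; exact ENNReal.ofReal_ne_top)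
  have he : ∫ t in Ioi (0 : ℝ), t ^ (δ - 1) / (t + ν) =
      ν ^ (δ - 1) * (Real.pi / Real.sin (Real.pi * δ)) := by
    rw [integral_eq_lintegral_of_nonneg_ae hnn hm, hl,
      ENNReal.toReal_ofReal (mul_nonneg (by positivity) (by positivity))]
  have hf : (fun t : ℝ => t ^ (δ - 1) * (ν / (t + ν))) =
      fun t => ν * (t ^ (δ - 1) / (t + ν)) := by
    ext t; ring
  rw [hf]
  refine ⟨hi.const_mul ν, ?_⟩
  rw [integral_const_mul, he, ← mul_assoc, Real.rpow_sub_one hν.ne', mul_div_cancel₀ _ hν.ne']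

/-- The shift `u = t + ν` identifies the integrand of `n₂` with the last summand of the loss kernel
under the Mellin weight. -/
lemma n₂Integrand_add {α t : ℝ} (ht : 0 < t) :
    n₂Integrand α ν (t + ν) = t ^ (2 / α - 1) * (t * Real.exp (-(t + ν)) / (t + ν)) := by
  rw [n₂Integrand, add_sub_cancel_right, Real.rpow_neg ht.le, Real.rpow_sub_one ht.ne']
  field_simp

/-- The Gamma integrand dominates, because `t/(t + ν) ≤ 1` and `exp (-(t + ν)) ≤ exp (-t)`. -/
lemma integrableOn_n₂Integrand_add {α : ℝ} (hα : 0 < α) (hν : 0 < ν) :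
    IntegrableOn (fun t => n₂Integrand α ν (t + ν)) (Ioi 0) := by
  have hg := Real.GammaIntegral_convergent (s := 2 / α) (by positivity)
  refine Integrable.mono' hg (Measurable.aestronglyMeasurable ?_) ?_
  · unfold n₂Integrand; fun_prop
  · filter_upwards [ae_restrict_mem measurableSet_Ioi] with t ht
    have ht' : (0 : ℝ) < t := ht
    rw [n₂Integrand_add ht', Real.norm_of_nonneg (by positivity), mul_comm]
    refine mul_le_mul_of_nonneg_right ?_ (by positivity)
    rw [div_le_iff₀ (by positivity), mul_comm]
    exact mul_le_mul (Real.exp_le_exp.2 (by linarith)) (by linarith) ht'.le (Real.exp_pos _).le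

lemma integrableOn_n₂Integrand {α : ℝ} (hα : 0 < α) (hν : 0 < ν) :
    IntegrableOn (n₂Integrand α ν) (Ioi ν) := by
  have h := (measurePreserving_add_right volume ν).integrableOn_comp_preimage
    (measurableEmbedding_addRight ν) (f := n₂Integrand α ν) (s := Ioi ν)
  rw [← h]
  simpa [Function.comp_def] using integrableOn_n₂Integrand_add hα hν

lemma integral_n₂Integrand_add {α : ℝ} :
    ∫ t in Ioi 0, n₂Integrand α ν (t + ν) = n₂ α ν := by
  have h := (measurePreserving_add_right volume ν).setIntegral_preimage_emb
    (measurableEmbedding_addRight ν) (n₂Integrand α ν) (Ioi ν)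
  simpa [n₂] using h

/-- The Mellin transform of the loss kernel at `2 / α`. -/
lemma hasIntegral_lossKernel {α : ℝ} (hα : 2 < α) (hν : 0 < ν) :
    IntegrableOn (fun t => t ^ (2 / α - 1) * lossKernel ν t) (Ioi 0) ∧
      ∫ t in Ioi 0, t ^ (2 / α - 1) * lossKernel ν t =
        ν ^ (2 / α) * n₁ α - Real.Gamma (2 / α) + n₂ α ν := by
  have hα0 : 0 < α := by linarith
  have h0 : 0 < 2 / α := by positivity
  have h1 : 2 / α < 1 := (div_lt_one hα0).2 hα
  obtain ⟨i1, e1⟩ := hasIntegral_rpow_mul_div_add h0 h1 hν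
  have i2 := Real.GammaIntegral_convergent h0
  have i3 := integrableOn_n₂Integrand_add hα0 hν
  have hf : EqOn (fun t => t ^ (2 / α - 1) * lossKernel ν t)
      (fun t => t ^ (2 / α - 1) * (ν / (t + ν)) - Real.exp (-t) * t ^ (2 / α - 1)
        + n₂Integrand α ν (t + ν)) (Ioi 0) := by
    intro t ht
    simp only [n₂Integrand_add (mem_Ioi.1 ht), lossKernel]
    ring
  refine ⟨(integrableOn_congr_fun hf measurableSet_Ioi).2 ((i1.sub i2).add i3), ?_⟩
  have hadd := integral_add (i1.sub i2) i3
  simp only [Pi.sub_apply] at hadd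
  rw [setIntegral_congr_fun measurableSet_Ioi hf, hadd, integral_sub i1 i2, e1,
    ← Real.Gamma_eq_integral h0, integral_n₂Integrand_add, n₁, div_eq_mul_inv Real.pi]
  ring_nf

/-- Under `t = c x^α` one has `t^(2/α - 1) dt = α c^(2/α) x dx`. The change of variables is split
into the scaling by `c`, contained in `F`, and the power `x ↦ x^α`. -/
lemma hasIntegral_lossKernel_radial {α c : ℝ} (hα : 2 < α) (hν : 0 < ν) (hc : 0 < c) :
    IntegrableOn (fun x => lossKernel ν (c * x ^ α) * x) (Ioi 0) ∧
      ∫ x in Ioi 0, lossKernel ν (c * x ^ α) * x =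
        1 / α * (c ^ (2 / α))⁻¹ *
          (ν ^ (2 / α) * n₁ α - Real.Gamma (2 / α) + n₂ α ν) := by
  have hα0 : 0 < α := by linarith
  obtain ⟨i1, e1⟩ := hasIntegral_lossKernel hα hν
  let F : ℝ → ℝ := fun y => (c * y) ^ (2 / α - 1) * lossKernel ν (c * y)
  have hF : IntegrableOn F (Ioi 0) := by
    have := (integrableOn_Ioi_comp_mul_left_iff
      (fun t => t ^ (2 / α - 1) * lossKernel ν t) 0 hc).2 (by simpa using i1)
    exact this
  have hFe : ∫ y in Ioi 0, F y = c⁻¹ * (ν ^ (2 / α) * n₁ α - Real.Gamma (2 / α) + n₂ α ν) := by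
    have := integral_comp_mul_left_Ioi (fun t => t ^ (2 / α - 1) * lossKernel ν t) 0 hc
    rw [mul_zero, e1] at this
    exact this
  have hEq : EqOn (fun x => lossKernel ν (c * x ^ α) * x)
      (fun x => (1 / α * c ^ (1 - 2 / α)) * ((|α| * x ^ (α - 1)) • F (x ^ α))) (Ioi 0) := by
    intro x hx
    have hx' : (0 : ℝ) < x := hx
    have e3 : (c * x ^ α) ^ (2 / α - 1) = (c ^ (1 - 2 / α))⁻¹ * (x * (x ^ (α - 1))⁻¹) := by
      rw [Real.mul_rpow hc.le (by positivity), ← Real.rpow_mul hx'.le, ← Real.rpow_neg hc.le,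
        show α * (2 / α - 1) = 1 - (α - 1) by field_simp; ring, Real.rpow_sub hx' 1 (α - 1),
        Real.rpow_one, div_eq_mul_inv x, neg_sub]
    simp only [F, e3, abs_of_pos hα0, smul_eq_mul]
    have := (Real.rpow_pos_of_pos hc (1 - 2 / α)).ne'
    have := (Real.rpow_pos_of_pos hx' (α - 1)).ne'
    field_simp
  refine ⟨(integrableOn_congr_fun hEq measurableSet_Ioi).2
    (((integrableOn_Ioi_comp_rpow_iff F hα0.ne').2 hF).const_mul _), ?_⟩
  rw [setIntegral_congr_fun measurableSet_Ioi hEq, integral_const_mul,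
    integral_comp_rpow_Ioi F hα0.ne', hFe, Real.rpow_sub hc, Real.rpow_one]
  field_simp

end Integrals

attribute [fun_prop] measurable_expNeg

/-- With threshold `1` and mean `1/t`, the number `1 - lossKernel ν t` is the expectation of a
variable with values in `[0, 1]`. -/
lemma lossKernel_nonneg {ν t : ℝ} (hν : 0 < ν) (ht : 0 < t) : 0 ≤ lossKernel ν t := by
  have h := integral_expNeg_truncated_exp hν one_pos (one_div_pos.2 ht)
  have hm : Measurable fun g : ℝ => ENNReal.ofReal ν *
      ENNReal.ofReal ((if g * (1 / t) < 1 then 1 else 0) * (g * (1 / t))) := by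
    refine measurable_const.mul (ENNReal.measurable_ofReal.comp (Measurable.mul ?_ (by fun_prop)))
    exact Measurable.ite (measurableSet_lt (by fun_prop) measurable_const) measurable_const
      measurable_const
  have h1 := integral_mono (integrable_expNeg_comp hm)
    (integrable_const (μ := expMeasure 1) (1 : ℝ)) fun g => expNeg_le_one _
  rw [h] at h1
  simp only [mul_one, one_div_one_div, integral_const, probReal_univ, smul_eq_mul] at h1
  linarith

lemma lossKernel_le_one {ν t : ℝ} (hν : 0 < ν) (ht : 0 < t) : lossKernel ν t ≤ 1 := by
  have h := integral_expNeg_truncated_exp hν one_pos (one_div_pos.2 ht)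
  have h1 : 0 ≤ 1 - lossKernel (ν * 1) (1 / (1 / t)) := by
    rw [← h]
    exact integral_nonneg fun g => expNeg_nonneg _
  simp only [mul_one, one_div_one_div] at h1
  linarith

/-! ### The kernel of the exponent -/

namespace NetworkParams

variable (N : NetworkParams) {τ : ℝ}

lemma κ_pos (hρ : 0 < N.ρ) (hpP : 0 < N.pP) (hrP : 0 < N.rP) (hPr0 : 0 < N.gPr 0)
    (hPt0 : 0 < N.gPt 0) : 0 < N.κ := by
  unfold κ; positivity

/-- With `t = ρ x^α/(p_s D)` and `ν = κτ`, the two exponents in the kernel are `t` and `t + ν`, and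
the denominator is `1 + ν/t`. -/
lemma kernel_eq_of_gain_pos (hρ : 0 < N.ρ) (hpS : 0 < N.pS) (hpP : 0 < N.pP) (hrP : 0 < N.rP)
    (hτ : 0 < τ) (hPr0 : 0 < N.gPr 0) (hPt0 : 0 < N.gPt 0) {x θ ω : ℝ} (hx : 0 < x)
    (hg : 0 < N.gain θ ω) :
    N.kernel τ x θ ω = 1 - lossKernel (N.κ * τ) (N.ρ / (N.pS * N.gain θ ω) * x ^ N.α) := by
  have hg₀ : 0 < N.gain₀ := mul_pos hPr0 hPt0
  have hκ := N.κ_pos hρ hpP hrP hPr0 hPt0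
  unfold kernel
  generalize N.gain θ ω = D at hg ⊢
  have hX : 0 < x ^ N.α := Real.rpow_pos_of_pos hx _
  have hR : 0 < N.rP ^ N.α := Real.rpow_pos_of_pos hrP _
  have hκ' : N.κ = N.ρ * N.rP ^ N.α / (N.pP * N.gain₀) := by
    rw [κ, gain₀]; ring_nf
  rw [Real.div_rpow hx.le hrP.le]
  generalize N.gain₀ = D₀ at hg₀ hκ' ⊢
  generalize x ^ N.α = A at hX ⊢
  generalize N.rP ^ N.α = R at hR hκ' ⊢
  rw [← ENNReal.ofReal_div_of_pos (by positivity), ← ENNReal.ofReal_div_of_pos hg,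
    ← ENNReal.ofReal_mul (by positivity), ← ENNReal.ofReal_add (by positivity) (by positivity),
    ← ENNReal.ofReal_mul (by positivity), expNeg_ofReal (by positivity),
    expNeg_ofReal (by positivity)]
  have e1 : N.ρ * R / (N.pS * D₀) * (τ * (N.pS / N.pP) + A / R * (D₀ / D)) =
      N.ρ / (N.pS * D) * A + N.κ * τ := by
    rw [hκ']; field_simp; ring
  have e2 : τ * (N.pS / N.pP) * (1 / (A / R)) * (D / D₀) =
      N.κ * τ / (N.ρ / (N.pS * D) * A) := by
    rw [hκ']; field_simp
  have e3 : N.ρ * A / (N.pS * D) = N.ρ / (N.pS * D) * A := by ring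
  rw [e1, e2, e3]
  have ht : 0 < N.ρ / (N.pS * D) * A := by positivity
  generalize N.ρ / (N.pS * D) * A = t at ht ⊢
  have hν : 0 < N.κ * τ := by positivity
  generalize N.κ * τ = ν at hν ⊢
  unfold lossKernel
  generalize Real.exp (-(t + ν)) = E
  have : 0 < t + ν := by positivity
  have : ν + t ≠ 0 := by positivity
  field_simp
  ring

lemma kernel_eq_of_gain_eq_zero (hρ : 0 < N.ρ) (hpS : 0 < N.pS) (hrP : 0 < N.rP)
    (hPr0 : 0 < N.gPr 0) (hPt0 : 0 < N.gPt 0) {x θ ω : ℝ} (hx : 0 < x)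
    (hg : N.gain θ ω = 0) : N.kernel τ x θ ω = 1 := by
  have hg₀ : 0 < N.gain₀ := mul_pos hPr0 hPt0
  -- These are needed because `0 / 0 = 0` and `0 * ⊤ = 0` in `ℝ≥0∞`; with nonzero factors both
  -- exponents become `⊤`.
  have h1 : ENNReal.ofReal (N.ρ * x ^ N.α) ≠ 0 := by
    simpa using (by positivity : 0 < N.ρ * x ^ N.α)
  have h2 : ENNReal.ofReal N.gain₀ ≠ 0 := by simpa using hg₀
  have h3 : ENNReal.ofReal ((x / N.rP) ^ N.α) ≠ 0 := by
    simpa using (by positivity : 0 < (x / N.rP) ^ N.α)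
  have h4 : ENNReal.ofReal (N.ρ * N.rP ^ N.α / (N.pS * N.gain₀)) ≠ 0 := by
    simpa using (by positivity : 0 < N.ρ * N.rP ^ N.α / (N.pS * N.gain₀))
  simp only [kernel, hg, mul_zero, ENNReal.ofReal_zero, ENNReal.div_zero h1, ENNReal.div_zero h2,
    ENNReal.mul_top h3, add_top, ENNReal.mul_top h4, expNeg_top]
  simp

lemma kernel_mem_Icc (hρ : 0 < N.ρ) (hpS : 0 < N.pS) (hpP : 0 < N.pP) (hrP : 0 < N.rP)
    (hτ : 0 < τ) (hPr : IsBeamPattern N.gPr) (hSt : IsBeamPattern N.gSt) (hPr0 : 0 < N.gPr 0)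
    (hPt0 : 0 < N.gPt 0) {x : ℝ} (hx : 0 < x) (θ ω : ℝ) :
    N.kernel τ x θ ω ∈ Icc (0 : ℝ) 1 := by
  rcases (N.gain_nonneg hPr hSt θ ω).eq_or_lt with hg | hg
  · rw [N.kernel_eq_of_gain_eq_zero hρ hpS hrP hPr0 hPt0 hx hg.symm]
    simp
  · rw [N.kernel_eq_of_gain_pos hρ hpS hpP hrP hτ hPr0 hPt0 hx hg]
    have hν := mul_pos (N.κ_pos hρ hpP hrP hPr0 hPt0) hτ
    have ht : 0 < N.ρ / (N.pS * N.gain θ ω) * x ^ N.α := by positivity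
    exact ⟨sub_nonneg.2 (lossKernel_le_one hν ht), by linarith [lossKernel_nonneg hν ht]⟩

lemma measurable_kernel (hPr : IsBeamPattern N.gPr) (hSt : IsBeamPattern N.gSt) :
    Measurable fun p : (ℝ × ℝ) × ℝ => N.kernel τ p.1.2 p.1.1 p.2 := by
  have hg : Measurable fun p : (ℝ × ℝ) × ℝ => N.gain p.1.1 p.2 :=
    (N.measurable_gain hPr hSt).comp (by fun_prop : Measurable fun p : (ℝ × ℝ) × ℝ => (p.1.1, p.2))
  unfold kernel
  fun_prop

lemma integrable_kernel (hρ : 0 < N.ρ) (hpS : 0 < N.pS) (hpP : 0 < N.pP) (hrP : 0 < N.rP)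
    (hτ : 0 < τ) (hPr : IsBeamPattern N.gPr) (hSt : IsBeamPattern N.gSt) (hPr0 : 0 < N.gPr 0)
    (hPt0 : 0 < N.gPt 0) {x : ℝ} (hx : 0 < x) (θ : ℝ) :
    Integrable (fun w => N.kernel τ x θ w) uniformAngle := by
  refine Integrable.of_bound ((N.measurable_kernel hPr hSt).comp
    (measurable_prodMk_left (x := (θ, x)))).aestronglyMeasurable 1 (ae_of_all _ fun w => ?_)
  have h := N.kernel_mem_Icc hρ hpS hpP hrP hτ hPr hSt hPr0 hPt0 hx θ w
  rw [Real.norm_of_nonneg h.1]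
  exact h.2

/-- By Fubini the fading is integrated first, through the truncated exponential of mean `p_s D
‖z‖^(-α)`; the average over the beam direction remains. Excluding the origin is harmless, since
polar coordinates omit it. -/
lemma contributionLaplace_eq (hρ : 0 < N.ρ) (hpS : 0 < N.pS) (hpP : 0 < N.pP) (hrP : 0 < N.rP)
    (hτ : 0 < τ) (hPr : IsBeamPattern N.gPr) (hSt : IsBeamPattern N.gSt) (hPr0 : 0 < N.gPr 0)
    (hPt0 : 0 < N.gPt 0) {z : ℂ} (hz : z ≠ 0) :
    N.contributionLaplace (N.κ * τ / N.ρ) z = ∫ w, N.kernel τ ‖z‖ z.arg w ∂uniformAngle := by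
  have hx : 0 < ‖z‖ := norm_pos_iff.2 hz
  have hκ := N.κ_pos hρ hpP hrP hPr0 hPt0
  unfold contributionLaplace
  refine (integral_prod _ (integrable_expNeg_comp
    ((N.measurable_weighted_contribution hPr hSt _).comp (measurable_prodMk_left (x := z))))).trans ?_
  refine integral_congr_ae (ae_of_all _ fun w => ?_)
  simp only [contribution, activity, receivedPower_eq, Function.comp_apply]
  rcases (N.gain_nonneg hPr hSt z.arg w).eq_or_lt with hg | hg
  · rw [N.kernel_eq_of_gain_eq_zero hρ hpS hrP hPr0 hPt0 hx hg.symm]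
    simp [← hg]
  · have hq : 0 < N.pS * N.gain z.arg w * ‖z‖ ^ (-N.α) := by positivity
    rw [N.kernel_eq_of_gain_pos hρ hpS hpP hrP hτ hPr0 hPt0 hx hg]
    have h1 := integral_expNeg_truncated_exp (s := N.κ * τ / N.ρ) (by positivity) hρ hq
    rw [div_mul_cancel₀ _ hρ.ne'] at h1
    rw [show N.ρ / (N.pS * N.gain z.arg w) * ‖z‖ ^ N.α =
      N.ρ / (N.pS * N.gain z.arg w * ‖z‖ ^ (-N.α)) by rw [Real.rpow_neg hx.le]; field_simp, ← h1]

/-! ### The exponent in polar coordinates -/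

/-- The factor of `n₃` in the exponent of the closed form, divided by the density. -/
noncomputable def exponentFactor (τ : ℝ) : ℝ :=
  1 / N.α * (N.pS ^ (2 / N.α) / N.ρ ^ (2 / N.α)) *
    ((N.κ * τ) ^ (2 / N.α) * n₁ N.α - Real.Gamma (2 / N.α) + n₂ N.α (N.κ * τ))

lemma exponentFactor_nonneg (hα : 2 < N.α) (hρ : 0 < N.ρ) (hpS : 0 < N.pS) (hpP : 0 < N.pP)
    (hrP : 0 < N.rP) (hτ : 0 < τ) (hPr0 : 0 < N.gPr 0) (hPt0 : 0 < N.gPt 0) :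
    0 ≤ N.exponentFactor τ := by
  have hα0 : 0 < N.α := by linarith
  have hν := mul_pos (N.κ_pos hρ hpP hrP hPr0 hPt0) hτ
  refine mul_nonneg (by positivity) ?_
  rw [← (hasIntegral_lossKernel hα hν).2]
  refine setIntegral_nonneg measurableSet_Ioi fun t ht => ?_
  exact mul_nonneg (Real.rpow_nonneg (le_of_lt ht) _) (lossKernel_nonneg hν ht)

/-- For `D > 0` the factor `c^(-2/α)` with `c = ρ/(p_s D)` supplies the power of the gain. For `D =
0` the kernel is `1` and both sides vanish. -/
lemma lintegral_radial (hα : 2 < N.α) (hρ : 0 < N.ρ) (hpS : 0 < N.pS) (hpP : 0 < N.pP)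
    (hrP : 0 < N.rP) (hτ : 0 < τ) (hPr : IsBeamPattern N.gPr) (hSt : IsBeamPattern N.gSt)
    (hPr0 : 0 < N.gPr 0) (hPt0 : 0 < N.gPt 0) (θ ω : ℝ) :
    ∫⁻ x in Ioi 0, ENNReal.ofReal ((1 - N.kernel τ x θ ω) * x) =
      ENNReal.ofReal (N.exponentFactor τ * N.gain θ ω ^ (2 / N.α)) := by
  have hα0 : 0 < N.α := by linarith
  have hν := mul_pos (N.κ_pos hρ hpP hrP hPr0 hPt0) hτ
  rcases (N.gain_nonneg hPr hSt θ ω).eq_or_lt with hg | hg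
  · rw [← hg, Real.zero_rpow (by positivity), mul_zero, ENNReal.ofReal_zero]
    refine (setLIntegral_congr_fun measurableSet_Ioi fun x hx => ?_).trans lintegral_zero
    simp [N.kernel_eq_of_gain_eq_zero hρ hpS hrP hPr0 hPt0 hx hg.symm]
  · have hc : 0 < N.ρ / (N.pS * N.gain θ ω) := by positivity
    obtain ⟨hi, he⟩ := hasIntegral_lossKernel_radial hα hν hc
    have h1 : ∫⁻ x in Ioi 0, ENNReal.ofReal ((1 - N.kernel τ x θ ω) * x) =
        ∫⁻ x in Ioi 0, ENNReal.ofReal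
          (lossKernel (N.κ * τ) (N.ρ / (N.pS * N.gain θ ω) * x ^ N.α) * x) := by
      refine setLIntegral_congr_fun measurableSet_Ioi fun x hx => ?_
      simp [N.kernel_eq_of_gain_pos hρ hpS hpP hrP hτ hPr0 hPt0 hx hg]
    rw [h1, ← ofReal_integral_eq_lintegral_ofReal hi, he, exponentFactor,
      Real.div_rpow hρ.le (by positivity), Real.mul_rpow hpS.le hg.le]
    · congr 1
      field_simp
    · filter_upwards [ae_restrict_mem measurableSet_Ioi] with x hx
      have hx' : (0 : ℝ) < x := hx
      exact mul_nonneg (lossKernel_nonneg hν (by positivity)) hx'.le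

/-- The integrand of the exponent in polar coordinates. -/
noncomputable def polarIntegrand (τ θ x : ℝ) : ℝ :=
  (1 - ∫ w, N.kernel τ x θ w ∂uniformAngle) * x

lemma measurable_polarIntegrand (hPr : IsBeamPattern N.gPr) (hSt : IsBeamPattern N.gSt) :
    Measurable fun q : ℝ × ℝ => N.polarIntegrand τ q.1 q.2 := by
  have h : StronglyMeasurable fun q : ℝ × ℝ => ∫ w, N.kernel τ q.2 q.1 w ∂uniformAngle :=
    (N.measurable_kernel hPr hSt).stronglyMeasurable.integral_prod_right
      (f := fun (q : ℝ × ℝ) w => N.kernel τ q.2 q.1 w)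
  exact (measurable_const.sub h.measurable).mul measurable_snd

lemma polarIntegrand_add_two_pi (hPr : IsBeamPattern N.gPr) (hSt : IsBeamPattern N.gSt)
    (θ x : ℝ) : N.polarIntegrand τ (θ + 2 * Real.pi) x = N.polarIntegrand τ θ x := by
  simp only [polarIntegrand, kernel, N.gain_add_two_pi hPr hSt]

lemma polarIntegrand_nonneg (hρ : 0 < N.ρ) (hpS : 0 < N.pS) (hpP : 0 < N.pP) (hrP : 0 < N.rP)
    (hτ : 0 < τ) (hPr : IsBeamPattern N.gPr) (hSt : IsBeamPattern N.gSt) (hPr0 : 0 < N.gPr 0)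
    (hPt0 : 0 < N.gPt 0) {x : ℝ} (hx : 0 < x) (θ : ℝ) : 0 ≤ N.polarIntegrand τ θ x := by
  refine mul_nonneg (sub_nonneg.2 ?_) hx.le
  have := integral_mono (N.integrable_kernel hρ hpS hpP hrP hτ hPr hSt hPr0 hPt0 hx θ)
    (integrable_const (1 : ℝ))
    fun w => (N.kernel_mem_Icc hρ hpS hpP hrP hτ hPr hSt hPr0 hPt0 hx θ w).2
  simpa using this

lemma ofReal_polarIntegrand (hρ : 0 < N.ρ) (hpS : 0 < N.pS) (hpP : 0 < N.pP) (hrP : 0 < N.rP)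
    (hτ : 0 < τ) (hPr : IsBeamPattern N.gPr) (hSt : IsBeamPattern N.gSt) (hPr0 : 0 < N.gPr 0)
    (hPt0 : 0 < N.gPt 0) {x : ℝ} (hx : 0 < x) (θ : ℝ) :
    ENNReal.ofReal (N.polarIntegrand τ θ x) =
      ∫⁻ w, ENNReal.ofReal ((1 - N.kernel τ x θ w) * x) ∂uniformAngle := by
  have hi := N.integrable_kernel hρ hpS hpP hrP hτ hPr hSt hPr0 hPt0 hx θ
  have hi' : Integrable (fun w => 1 - N.kernel τ x θ w) uniformAngle :=
    (integrable_const (1 : ℝ)).sub hi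
  have h2 := integral_sub (integrable_const (μ := uniformAngle) (1 : ℝ)) hi
  rw [← ofReal_integral_eq_lintegral_ofReal (hi'.mul_const x), integral_mul_const]
  · rw [h2]
    simp [polarIntegrand]
  · refine ae_of_all _ fun w => mul_nonneg (sub_nonneg.2 ?_) hx.le
    exact (N.kernel_mem_Icc hρ hpS hpP hrP hτ hPr hSt hPr0 hPt0 hx θ w).2

/-- Tonelli moves the average over `ω` outside the radial integral, which leaves a constant times
the gain to the power `2/α`; its mean over both angles is `n₃`. -/
lemma lintegral_polarIntegrand (hα : 2 < N.α) (hρ : 0 < N.ρ) (hpS : 0 < N.pS) (hpP : 0 < N.pP)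
    (hrP : 0 < N.rP) (hτ : 0 < τ) (hPr : IsBeamPattern N.gPr) (hSt : IsBeamPattern N.gSt)
    (hPr0 : 0 < N.gPr 0) (hPt0 : 0 < N.gPt 0)
    (hdir : Integrable (fun q : ℝ × ℝ => N.gain q.1 q.2 ^ (2 / N.α))
      ((volume.restrict (Ioc 0 (2 * Real.pi))).prod uniformAngle)) :
    ∫⁻ θ in Ioc 0 (2 * Real.pi), ∫⁻ x in Ioi 0, ENNReal.ofReal (N.polarIntegrand τ θ x) =
      ENNReal.ofReal (N.exponentFactor τ * N.n₃) := by
  have h1 : ∀ θ, ∫⁻ x in Ioi 0, ENNReal.ofReal (N.polarIntegrand τ θ x) =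
      ∫⁻ w, ENNReal.ofReal (N.exponentFactor τ * N.gain θ w ^ (2 / N.α)) ∂uniformAngle := by
    intro θ
    rw [setLIntegral_congr_fun measurableSet_Ioi fun x hx =>
      N.ofReal_polarIntegrand hρ hpS hpP hrP hτ hPr hSt hPr0 hPt0 hx θ, lintegral_lintegral_swap]
    · simp_rw [N.lintegral_radial hα hρ hpS hpP hrP hτ hPr hSt hPr0 hPt0]
    · have hk := (N.measurable_kernel (τ := τ) hPr hSt).comp
        (by fun_prop : Measurable fun p : ℝ × ℝ => ((θ, p.1), p.2))
      simp only [Function.comp_def] at hk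
      have h : Measurable fun p : ℝ × ℝ => ENNReal.ofReal ((1 - N.kernel τ p.1 θ p.2) * p.1) := by
        fun_prop
      exact h.aemeasurable
  have hC := N.exponentFactor_nonneg hα hρ hpS hpP hrP hτ hPr0 hPt0
  have hn₃ : N.n₃ = ∫ q, N.gain q.1 q.2 ^ (2 / N.α)
      ∂((volume.restrict (Ioc 0 (2 * Real.pi))).prod uniformAngle) := by
    rw [integral_prod_symm _ hdir]
    simp only [n₃, intervalIntegral.integral_of_le Real.two_pi_pos.le]
  have hm : Measurable fun q : ℝ × ℝ =>
      ENNReal.ofReal (N.exponentFactor τ * N.gain q.1 q.2 ^ (2 / N.α)) := by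
    have := N.measurable_gain hPr hSt
    fun_prop
  simp_rw [h1]
  rw [← lintegral_prod (fun q : ℝ × ℝ =>
    ENNReal.ofReal (N.exponentFactor τ * N.gain q.1 q.2 ^ (2 / N.α))) hm.aemeasurable, hn₃,
    ← integral_const_mul, ofReal_integral_eq_lintegral_ofReal (hdir.const_mul _)]
  exact ae_of_all _ fun q => mul_nonneg hC (Real.rpow_nonneg (N.gain_nonneg hPr hSt _ _) _)

/-- Up to a null set both intervals are fundamental domains for translation by `2π`. This reconciles
the range of `Complex.arg` with the angles in the theorem. -/
lemma setLIntegral_Ioo_eq_of_periodic {f : ℝ → ℝ≥0∞} (hf : Function.Periodic f (2 * Real.pi)) :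
    ∫⁻ θ in Ioo (-Real.pi) Real.pi, f θ = ∫⁻ θ in Ioc 0 (2 * Real.pi), f θ := by
  have h1 := isAddFundamentalDomain_Ioc Real.two_pi_pos (-Real.pi)
  have h2 := isAddFundamentalDomain_Ioc Real.two_pi_pos 0
  rw [show -Real.pi + 2 * Real.pi = Real.pi by ring] at h1
  rw [zero_add] at h2
  rw [setLIntegral_congr Ioo_ae_eq_Ioc]
  refine h1.setLIntegral_eq h2 f ?_
  rintro ⟨_, n, rfl⟩ x
  have := hf.zsmul n x
  rw [add_comm] at this
  exact this

lemma lintegral_contributionLaplace (hρ : 0 < N.ρ) (hpS : 0 < N.pS)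
    (hpP : 0 < N.pP) (hrP : 0 < N.rP) (hτ : 0 < τ) (hPr : IsBeamPattern N.gPr)
    (hSt : IsBeamPattern N.gSt) (hPr0 : 0 < N.gPr 0) (hPt0 : 0 < N.gPt 0) :
    ∫⁻ z, ENNReal.ofReal (1 - N.contributionLaplace (N.κ * τ / N.ρ) z) =
      ∫⁻ θ in Ioc 0 (2 * Real.pi), ∫⁻ x in Ioi 0, ENNReal.ofReal (N.polarIntegrand τ θ x) := by
  have hm := ENNReal.measurable_ofReal.comp
    ((N.measurable_polarIntegrand (τ := τ) hPr hSt).comp measurable_swap)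
  simp only [Function.comp_def, Prod.fst_swap, Prod.snd_swap] at hm
  -- The Jacobian `p.1` becomes the factor `x` of the polar integrand.
  have hp : ∀ p ∈ Ioi (0 : ℝ) ×ˢ Ioo (-Real.pi) Real.pi, ENNReal.ofReal p.1 • ENNReal.ofReal
      (1 - N.contributionLaplace (N.κ * τ / N.ρ) (Complex.polarCoord.symm p)) =
        ENNReal.ofReal (N.polarIntegrand τ p.2 p.1) := by
    intro p hp
    have hr : (0 : ℝ) < p.1 := hp.1
    have hpol : Complex.polarCoord.symm p =
        p.1 * (Complex.cos p.2 + Complex.sin p.2 * Complex.I) := by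
      rw [Complex.polarCoord_symm_apply]; push_cast; rfl
    have hnorm : ‖Complex.polarCoord.symm p‖ = p.1 := by
      rw [Complex.norm_polarCoord_symm, abs_of_pos hr]
    have harg : (Complex.polarCoord.symm p).arg = p.2 := by
      rw [hpol]
      exact Complex.arg_mul_cos_add_sin_mul_I hr ⟨hp.2.1, hp.2.2.le⟩
    have hz : Complex.polarCoord.symm p ≠ 0 := norm_pos_iff.1 (hnorm ▸ hr)
    rw [N.contributionLaplace_eq hρ hpS hpP hrP hτ hPr hSt hPr0 hPt0 hz, hnorm, harg, smul_eq_mul,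
      ← ENNReal.ofReal_mul hr.le, polarIntegrand, mul_comm]
  rw [← Complex.lintegral_comp_polarCoord_symm, polarCoord_target,
    setLIntegral_congr_fun (measurableSet_Ioi.prod measurableSet_Ioo) hp, Measure.volume_eq_prod,
    ← Measure.prod_restrict, lintegral_prod_symm _ hm.aemeasurable]
  refine setLIntegral_Ioo_eq_of_periodic fun θ => ?_
  simp only [N.polarIntegrand_add_two_pi hPr hSt]

/-- The coverage probability as the exponential of a multiple of the average directivity. -/
theorem coverage_eq_exp {Ω : Type*} [MeasurableSpace Ω] {P : Measure Ω}
    [IsProbabilityMeasure P] {X : ℕ → Ω → ℂ} {ω G : ℕ → Ω → ℝ} {H : Ω → ℝ} (hα : 2 < N.α)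
    (hlam : 0 < N.lam) (hρ : 0 < N.ρ) (hpS : 0 < N.pS) (hpP : 0 < N.pP) (hrP : 0 < N.rP)
    (hτ : 0 < τ) (hPr : IsBeamPattern N.gPr) (hSt : IsBeamPattern N.gSt)
    (hPr0 : 0 < N.gPr 0) (hPt0 : 0 < N.gPt 0)
    (hdir : Integrable (fun q : ℝ × ℝ => N.gain q.1 q.2 ^ (2 / N.α))
      ((volume.restrict (Ioc 0 (2 * Real.pi))).prod uniformAngle))
    (hnet : IsNetwork P N.lam X ω G H) :
    N.coverage P X ω G H τ = Real.exp (-(N.σ ^ 2 * N.κ * τ / N.ρ)) *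
      Real.exp (-N.lam * (N.exponentFactor τ * N.n₃)) := by
  have hκ := N.κ_pos hρ hpP hrP hPr0 hPt0
  have hC := N.exponentFactor_nonneg hα hρ hpS hpP hrP hτ hPr0 hPt0
  have hn₃ : 0 ≤ N.n₃ := integral_nonneg fun w =>
    intervalIntegral.integral_nonneg_of_forall Real.two_pi_pos.le fun θ =>
      Real.rpow_nonneg (N.gain_nonneg hPr hSt θ w) _
  rw [N.coverage_eq_expNeg hlam hρ hpP hrP hτ hPr hSt hPr0 hPt0 hnet,
    N.lintegral_contributionLaplace hρ hpS hpP hrP hτ hPr hSt hPr0 hPt0,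
    N.lintegral_polarIntegrand hα hρ hpS hpP hrP hτ hPr hSt hPr0 hPt0 hdir,
    ← ENNReal.ofReal_mul (by positivity), ← ENNReal.ofReal_mul hlam.le,
    expNeg_ofReal (by positivity), expNeg_ofReal (by positivity)]
  ring_nf

/-- The integrand is nonnegative on the domain and its Lebesgue integral is a known finite number,
so it is integrable and Fubini gives the iterated integral. -/
lemma integrable_polarIntegrand (hα : 2 < N.α) (hρ : 0 < N.ρ) (hpS : 0 < N.pS) (hpP : 0 < N.pP)
    (hrP : 0 < N.rP) (hτ : 0 < τ) (hPr : IsBeamPattern N.gPr) (hSt : IsBeamPattern N.gSt)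
    (hPr0 : 0 < N.gPr 0) (hPt0 : 0 < N.gPt 0)
    (hdir : Integrable (fun q : ℝ × ℝ => N.gain q.1 q.2 ^ (2 / N.α))
      ((volume.restrict (Ioc 0 (2 * Real.pi))).prod uniformAngle)) :
    IntegrableOn (fun q : ℝ × ℝ => N.polarIntegrand τ q.1 q.2) (Ioc 0 (2 * Real.pi) ×ˢ Ioi 0) ∧
      ∫ θ in (0 : ℝ)..(2 * Real.pi), ∫ x in Ioi (0 : ℝ), N.polarIntegrand τ θ x =
        N.exponentFactor τ * N.n₃ := by
  have hC := N.exponentFactor_nonneg hα hρ hpS hpP hrP hτ hPr0 hPt0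
  have hn₃ : 0 ≤ N.n₃ := integral_nonneg fun w =>
    intervalIntegral.integral_nonneg_of_forall Real.two_pi_pos.le fun θ =>
      Real.rpow_nonneg (N.gain_nonneg hPr hSt θ w) _
  have hm := N.measurable_polarIntegrand (τ := τ) hPr hSt
  have hl : ∫⁻ q in Ioc 0 (2 * Real.pi) ×ˢ Ioi 0, ENNReal.ofReal (N.polarIntegrand τ q.1 q.2) =
      ENNReal.ofReal (N.exponentFactor τ * N.n₃) := by
    rw [← N.lintegral_polarIntegrand hα hρ hpS hpP hrP hτ hPr hSt hPr0 hPt0 hdir,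
      Measure.volume_eq_prod, ← Measure.prod_restrict]
    exact lintegral_prod _ (ENNReal.measurable_ofReal.comp hm).aemeasurable
  have hnn : 0 ≤ᵐ[volume.restrict (Ioc 0 (2 * Real.pi) ×ˢ Ioi 0)]
      fun q : ℝ × ℝ => N.polarIntegrand τ q.1 q.2 := by
    filter_upwards [ae_restrict_mem (measurableSet_Ioc.prod measurableSet_Ioi)] with q hq
    exact N.polarIntegrand_nonneg hρ hpS hpP hrP hτ hPr hSt hPr0 hPt0 hq.2 q.1
  have hi : IntegrableOn (fun q : ℝ × ℝ => N.polarIntegrand τ q.1 q.2)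
      (Ioc 0 (2 * Real.pi) ×ˢ Ioi 0) :=
    (lintegral_ofReal_ne_top_iff_integrable hm.aestronglyMeasurable hnn).1
      (by rw [hl]; exact ENNReal.ofReal_ne_top)
  refine ⟨hi, ?_⟩
  have h1 := integral_eq_lintegral_of_nonneg_ae hnn hm.aestronglyMeasurable
  rw [hl, ENNReal.toReal_ofReal (mul_nonneg hC hn₃)] at h1
  rw [← h1, intervalIntegral.integral_of_le Real.two_pi_pos.le]
  unfold IntegrableOn at hi
  rw [Measure.volume_eq_prod, ← Measure.prod_restrict] at hi ⊢
  exact (integral_prod _ hi).symm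

end NetworkParams

theorem theorem2 {Ω : Type*} [MeasurableSpace Ω] (P : Measure Ω) [IsProbabilityMeasure P]
    (N : NetworkParams) (X : ℕ → Ω → ℂ) (ω G : ℕ → Ω → ℝ) (H : Ω → ℝ) (τ : ℝ)
    (hα : 2 < N.α) (hlam : 0 < N.lam) (hρ : 0 < N.ρ) (hpS : 0 < N.pS) (hpP : 0 < N.pP)
    (hrP : 0 < N.rP) (hτ : 0 < τ)
    (hPr : IsBeamPattern N.gPr) (hPt : IsBeamPattern N.gPt) (hSt : IsBeamPattern N.gSt)
    (hPr0 : 0 < N.gPr 0) (hPt0 : 0 < N.gPt 0)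
    -- the average secondary directivity is finite
    (hdir : Integrable (fun q : ℝ × ℝ => N.gain q.1 q.2 ^ (2 / N.α))
      ((volume.restrict (Ioc 0 (2 * Real.pi))).prod uniformAngle))
    (hnet : IsNetwork P N.lam X ω G H) :
    -- all integrals in the two formulas converge
    (∀ θ x : ℝ, 0 < x → Integrable (fun w => N.kernel τ x θ w) uniformAngle) ∧
    IntegrableOn (fun q : ℝ × ℝ => (1 - ∫ w, N.kernel τ q.2 q.1 w ∂uniformAngle) * q.2)
      (Ioc 0 (2 * Real.pi) ×ˢ Ioi 0) ∧
    IntegrableOn (n₂Integrand N.α (N.κ * τ)) (Ioi (N.κ * τ)) ∧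
    -- the formula with the double integral over the plane in polar coordinates
    N.coverage P X ω G H τ =
      Real.exp (-(τ * N.σ ^ 2 * N.rP ^ N.α / (N.pP * N.gPr 0 * N.gPt 0))) *
        Real.exp (-N.lam * ∫ θ in (0 : ℝ)..(2 * Real.pi), ∫ x in Ioi (0 : ℝ),
          (1 - ∫ w, N.kernel τ x θ w ∂uniformAngle) * x) ∧
    -- the closed form
    N.coverage P X ω G H τ =
      Real.exp (-(N.σ ^ 2 * N.κ * τ / N.ρ) -
        N.lam / N.α * (N.pS ^ (2 / N.α) / N.ρ ^ (2 / N.α)) *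
          (N.κ ^ (2 / N.α) * τ ^ (2 / N.α) * n₁ N.α - Real.Gamma (2 / N.α)
            + n₂ N.α (N.κ * τ)) * N.n₃) := by
  have hκ := N.κ_pos hρ hpP hrP hPr0 hPt0
  obtain ⟨hi, he⟩ := N.integrable_polarIntegrand hα hρ hpS hpP hrP hτ hPr hSt hPr0 hPt0 hdir
  have hcov := N.coverage_eq_exp hα hlam hρ hpS hpP hrP hτ hPr hSt hPr0 hPt0 hdir hnet
  refine ⟨fun θ x hx => N.integrable_kernel hρ hpS hpP hrP hτ hPr hSt hPr0 hPt0 hx θ, hi,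
    integrableOn_n₂Integrand (by linarith) (mul_pos hκ hτ), ?_, ?_⟩
  · simp only [NetworkParams.polarIntegrand] at he
    rw [he, hcov]
    -- Only the noise exponents differ, and they agree because `κτ/ρ` is `τ r_p^α` over the power
    -- and gains of the primary link.
    congr 2
    rw [NetworkParams.κ]
    field_simp
  · rw [hcov, ← Real.exp_add, NetworkParams.exponentFactor, Real.mul_rpow hκ.le hτ.le]
    congr 1
    ring
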